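/- Let $(\chi,\mu)$ be a probability space and let $k:\chi\times\chi\to\mathbb{R}$ be a product-measurable, symmetric kernel with $k\in L_2(\chi^2,\mu^2)$, positive semi-definite (for all finitely many points $x_1,\dots,x_m\in\chi$ the matrix $(k(x_i,x_j))_{i,j}$ is positive semi-definite) and with bounded diagonal: there is $B$ with $|k(x,x)|\le B$ for all $x\in\chi$. Let $\lambda_1$ be the largest eigenvalue of the integral operator $T_k:L_2(\chi,\mu)\to L_2(\chi,\mu)$, $(T_kf)(y)=\int_\chi k(x,y)f(x)\,d\mu(x)$, and assume $\lambda_1\neq 0$. Let $X_1,X_2,\dots:\Omega\to\chi$ be independent, $\mu$-distributed random variables on a probability space $\Omega$, and for each $m\ge 1$ let $K_m=(k(X_i,X_j))_{1\le i,j\le m}$ be the Gram matrix of the first $m$ of them (so $K_n$ is the leading principal submatrix of $K_m$ for $n<m$), with eigenvalues $\tilde\lambda_{1,m}\ge\dots\ge\tilde\lambda_{m,m}$. Then the limit $C(\omega)=\lim_{m\to\infty}\tilde\lambda_{m,m}(\omega)$ exists for every $\omega\in\Omega$ and defines a non-negative random variable $C$. For $\sigma>0$ let $$\kappa_{m,\sigma}=\frac{\tilde\lambda_{1,m}+\sigma^2}{\tilde\lambda_{m,m}+\sigma^2}$$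 be the condition number of $K_m+\sigma^2I$ (the ratio of its largest to its smallest eigenvalue). Then for every $\sigma>0$, almost surely, $$\lim_{m\to\infty}\frac{C+\sigma^2}{\lambda_1 m}\,\kappa_{m,\sigma}=1 .$$ -/

import Mathlib

open MeasureTheory ProbabilityTheory Filter Topology

noncomputable section

/-- For a.e. `y`, the section `x ↦ k x y` of a square integrable kernel is square integrable. -/
theorem kernel_section_memLp {χ : Type*} [MeasurableSpace χ] {μ : Measure χ} [SFinite μ]
    {k : χ → χ → ℝ} (hk : MemLp (Function.uncurry k) 2 (μ.prod μ)) :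
    ∀ᵐ y ∂μ, MemLp (fun x => k x y) 2 μ := by
  have hs : AEStronglyMeasurable (fun p : χ × χ => k p.2 p.1) (μ.prod μ) :=
    hk.1.prod_swap
  have hint : Integrable (fun p : χ × χ => (k p.2 p.1) ^ 2) (μ.prod μ) :=
    ((memLp_two_iff_integrable_sq hk.1).1 hk).swap
  filter_upwards [hs.prodMk_left, hint.prod_right_ae] with y h1 h2
  exact (memLp_two_iff_integrable_sq h1).2 h2

/-- The image of a square integrable function under the integral operator of a square integrable
kernel is square integrable. -/
theorem kernel_integral_memLp {χ : Type*} [MeasurableSpace χ] {μ : Measure χ} [SFinite μ]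
    {k : χ → χ → ℝ} (hk : MemLp (Function.uncurry k) 2 (μ.prod μ))
    {f : χ → ℝ} (hf : MemLp f 2 μ) :
    MemLp (fun y => ∫ x, k x y * f x ∂μ) 2 μ := by
  have hs : AEStronglyMeasurable (fun p : χ × χ => k p.2 p.1) (μ.prod μ) :=
    hk.1.prod_swap
  have hint : Integrable (fun p : χ × χ => (k p.2 p.1) ^ 2) (μ.prod μ) :=
    ((memLp_two_iff_integrable_sq hk.1).1 hk).swap
  have hmeas : AEStronglyMeasurable (fun y => ∫ x, k x y * f x ∂μ) μ :=
    (hs.mul hf.1.comp_snd).integral_prod_right'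
  rw [memLp_two_iff_integrable_sq hmeas]
  refine Integrable.mono' (hint.integral_prod_left.mul_const (∫ x, (f x) ^ 2 ∂μ))
    (hmeas.pow 2) ?_
  filter_upwards [kernel_section_memLp hk] with y hy
  have hcs := integral_mul_norm_le_Lp_mul_Lq (μ := μ) (p := 2) (q := 2)
    Real.HolderConjugate.two_two (f := fun x => k x y) (g := f)
    (by simpa using hy) (by simpa using hf)
  have h1 : ‖∫ x, k x y * f x ∂μ‖ ≤ ∫ x, ‖k x y‖ * ‖f x‖ ∂μ := by
    simpa only [norm_mul] using norm_integral_le_integral_norm (fun x => k x y * f x) (μ := μ)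
  have h2 := h1.trans hcs
  have ha : 0 ≤ ∫ x, (k x y) ^ 2 ∂μ := integral_nonneg fun _ => sq_nonneg _
  have hb : 0 ≤ ∫ x, (f x) ^ 2 ∂μ := integral_nonneg fun _ => sq_nonneg _
  simp only [Real.rpow_two, Real.norm_eq_abs, sq_abs, ← Real.sqrt_eq_rpow] at h2
  rw [← Real.sqrt_mul ha] at h2
  rw [Real.norm_eq_abs, abs_of_nonneg (sq_nonneg _), ← sq_abs]
  calc |∫ x, k x y * f x ∂μ| ^ 2
      ≤ (√((∫ x, (k x y) ^ 2 ∂μ) * ∫ x, (f x) ^ 2 ∂μ)) ^ 2 := by gcongr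
    _ = _ := Real.sq_sqrt (mul_nonneg ha hb)

/-- The integral operator `T_k : L²(μ) → L²(μ)`, `(T_k f)(y) = ∫ k(x, y) f(x) dμ(x)`, of a square
integrable kernel `k`. -/
def kernelOperator {χ : Type*} [MeasurableSpace χ] (μ : Measure χ) [SFinite μ]
    (k : χ → χ → ℝ) (hk : MemLp (Function.uncurry k) 2 (μ.prod μ)) :
    Lp ℝ 2 μ →ₗ[ℝ] Lp ℝ 2 μ where
  toFun f := (kernel_integral_memLp hk (Lp.memLp f)).toLp (fun y => ∫ x, k x y * f x ∂μ)
  map_add' f g := by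
    rw [← MemLp.toLp_add]
    refine MemLp.toLp_congr _ _ ?_
    filter_upwards [kernel_section_memLp hk] with y hy
    have h1 : Integrable (fun x => k x y * f x) μ := hy.integrable_mul (Lp.memLp f)
    have h2 : Integrable (fun x => k x y * g x) μ := hy.integrable_mul (Lp.memLp g)
    rw [Pi.add_apply, ← integral_add h1 h2]
    refine integral_congr_ae ?_
    filter_upwards [Lp.coeFn_add f g] with x hx
    rw [hx, Pi.add_apply, mul_add]
  map_smul' c f := by
    rw [RingHom.id_apply, ← MemLp.toLp_const_smul]
    refine MemLp.toLp_congr _ _ (Eventually.of_forall fun y => ?_)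
    simp only [Pi.smul_apply, smul_eq_mul, ← integral_const_mul]
    refine integral_congr_ae ?_
    filter_upwards [Lp.coeFn_smul c f] with x hx
    rw [hx, Pi.smul_apply, smul_eq_mul, mul_left_comm]

/-- The largest eigenvalue of a real linear operator. The set of eigenvalues is nonempty, bounded,
and contains its supremum for a symmetric matrix of positive size, and also for the integral
operator of a symmetric positive semi-definite kernel (a compact positive operator). -/
def topEigenvalue {V : Type*} [AddCommGroup V] [Module ℝ V] (T : V →ₗ[ℝ] V) : ℝ :=
  sSup {t : ℝ | Module.End.HasEigenvalue T t}

/-- The smallest eigenvalue of a real linear operator; used for symmetric matrices only, which have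
finitely many eigenvalues. -/
def bottomEigenvalue {V : Type*} [AddCommGroup V] [Module ℝ V] (T : V →ₗ[ℝ] V) : ℝ :=
  sInf {t : ℝ | Module.End.HasEigenvalue T t}

/-- The Gram matrix `(k (x i) (x j))` of the first `m` points of the sequence `x`. As all sizes `m`
use one sequence of points, a larger Gram matrix keeps the points of the smaller ones. -/
def gramMatrix {χ : Type*} (k : χ → χ → ℝ) (x : ℕ → χ) (m : ℕ) : Matrix (Fin m) (Fin m) ℝ :=
  Matrix.of fun i j => k (x i) (x j)

/-- The condition number of a symmetric positive definite matrix: the ratio of its largest to its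
smallest eigenvalue. -/
def conditionNumber {m : ℕ} (A : Matrix (Fin m) (Fin m) ℝ) : ℝ :=
  topEigenvalue (Matrix.toLin' A) / bottomEigenvalue (Matrix.toLin' A)

end

/-!
The smallest eigenvalue of the Gram matrix is nonincreasing in the number `m` of points, by
interlacing, and non-negative, so it converges at every `ω`. Adding `σ ^ 2` to the kernel matrix
shifts both extreme eigenvalues by `σ ^ 2`. Everything therefore reduces to the almost sure
convergence `topEigenvalue K_m / m → λ₁` (`ae_tendsto_topEigenvalue_gramMatrix`), where `λ₁` is the
largest eigenvalue of the integral operator `T`.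

A positive semi-definite kernel with bounded diagonal is bounded, so the only probabilistic tool
needed is a strong law of large numbers for V-statistics with bounded kernels,
`(1 / m²) ∑ i j, g (X i, X j) → ∫ g d(μ ⊗ μ)` (`ae_tendsto_vStatistic`). A second moment bound gives
convergence along the squares, and boundedness fills the gaps.

Lower bound: an eigenfunction of `T` for `λ₁` is bounded, because it is a multiple of its image
under `T`. Testing the form of `K_m` at its values on the sample, and applying the law of large
numbers to numerator and denominator of the Rayleigh quotient, gives `liminf ≥ λ₁`.

Upper bound: step kernels `c (Φ x) (Φ y)`, with `Φ` taking finitely many values, are dense in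
`L²(μ ⊗ μ)` (`exists_isStepKernel_eLpNorm_sub_le`). The empirical form of a step kernel is
controlled by its population form as soon as the cell frequencies are close to the cell probabilities
(`step_form_le`), and the remainder `r` contributes at most its Frobenius norm, which divided by `m`
converges to the `L²` norm of `r` by the law of large numbers for `r ^ 2`.

That `topEigenvalue T`, a supremum over eigenvalues, bounds the form of `T` and is itself an
eigenvalue follows from compactness of `T`, again by approximation with step kernels. The law of
large numbers also shows that `T` has no negative eigenvalue, so that `λ₁ ≠ 0` means `λ₁ > 0`.
-/

/-! ### Extreme eigenvalues of symmetric matrices -/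

section matrix
theorem Matrix.IsHermitian.sub_smul_one {n : Type*} [DecidableEq n] {A : Matrix n n ℝ}
    (hA : A.IsHermitian) (b : ℝ) :
    (A - b • (1 : Matrix n n ℝ)).IsHermitian := by
  refine hA.sub ?_
  simp [Matrix.IsHermitian]

variable {n : Type*} [Fintype n]

open Matrix

theorem Matrix.dotProduct_mulVec_eq_sum (A : Matrix n n ℝ) (u : n → ℝ) :
    star u ⬝ᵥ A *ᵥ u = ∑ i, ∑ j, A i j * (u i * u j) := by
  simp only [dotProduct, mulVec, Finset.mul_sum, Pi.star_apply, star_trivial]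
  exact Finset.sum_congr rfl fun i _ => Finset.sum_congr rfl fun j _ => by ring

variable [DecidableEq n]

theorem Matrix.setOf_hasEigenvalue_toLin' (A : Matrix n n ℝ) :
    {t : ℝ | Module.End.HasEigenvalue (Matrix.toLin' A) t} = spectrum ℝ A := by
  ext t
  rw [Set.mem_ofPred_eq, Module.End.hasEigenvalue_iff_mem_spectrum, Matrix.spectrum_toLin']

theorem Matrix.IsHermitian.posSemidef_iff_spectrum {A : Matrix n n ℝ} (hA : A.IsHermitian) :
    A.PosSemidef ↔ ∀ t ∈ spectrum ℝ A, 0 ≤ t := by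
  rw [hA.posSemidef_iff_eigenvalues_nonneg, hA.spectrum_real_eq_range_eigenvalues]
  simp [Pi.le_def]

theorem Matrix.IsHermitian.posSemidef_sub_smul_one_iff {A : Matrix n n ℝ} (hA : A.IsHermitian)
    (b : ℝ) : (A - b • (1 : Matrix n n ℝ)).PosSemidef ↔ ∀ t ∈ spectrum ℝ A, b ≤ t := by
  rw [(hA.sub_smul_one b).posSemidef_iff_spectrum, ← Algebra.algebraMap_eq_smul_one,
    ← spectrum.sub_singleton_eq]
  simp [Set.sub_singleton]

theorem Matrix.IsHermitian.posSemidef_smul_one_sub_iff {A : Matrix n n ℝ} (hA : A.IsHermitian)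
    (b : ℝ) : (b • (1 : Matrix n n ℝ) - A).PosSemidef ↔ ∀ t ∈ spectrum ℝ A, t ≤ b := by
  have h : (b • (1 : Matrix n n ℝ) - A).IsHermitian := by
    simpa using (hA.sub_smul_one b).neg
  rw [h.posSemidef_iff_spectrum, ← Algebra.algebraMap_eq_smul_one,
    ← spectrum.singleton_sub_eq]
  simp [Set.singleton_sub]

theorem Matrix.IsHermitian.spectrum_finite_nonempty [Nonempty n] {A : Matrix n n ℝ}
    (hA : A.IsHermitian) : (spectrum ℝ A).Finite ∧ (spectrum ℝ A).Nonempty := by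
  rw [hA.spectrum_real_eq_range_eigenvalues]
  exact ⟨Set.finite_range _, Set.range_nonempty _⟩

/-- The smallest eigenvalue of a symmetric matrix is characterized by its quadratic form. -/
theorem Matrix.IsHermitian.le_bottomEigenvalue_iff [Nonempty n] {A : Matrix n n ℝ}
    (hA : A.IsHermitian) {b : ℝ} :
    b ≤ bottomEigenvalue (Matrix.toLin' A) ↔ (A - b • (1 : Matrix n n ℝ)).PosSemidef := by
  rw [hA.posSemidef_sub_smul_one_iff, bottomEigenvalue, Matrix.setOf_hasEigenvalue_toLin',
    le_csInf_iff hA.spectrum_finite_nonempty.1.bddBelow hA.spectrum_finite_nonempty.2]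

/-- The largest eigenvalue of a symmetric matrix is characterized by its quadratic form. -/
theorem Matrix.IsHermitian.topEigenvalue_le_iff [Nonempty n] {A : Matrix n n ℝ}
    (hA : A.IsHermitian) {b : ℝ} :
    topEigenvalue (Matrix.toLin' A) ≤ b ↔ (b • (1 : Matrix n n ℝ) - A).PosSemidef := by
  rw [hA.posSemidef_smul_one_sub_iff, topEigenvalue, Matrix.setOf_hasEigenvalue_toLin',
    csSup_le_iff hA.spectrum_finite_nonempty.1.bddAbove hA.spectrum_finite_nonempty.2]

theorem Matrix.IsHermitian.bottomEigenvalue_add_smul_one [Nonempty n] {A : Matrix n n ℝ}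
    (hA : A.IsHermitian) (s : ℝ) :
    bottomEigenvalue (Matrix.toLin' (A + s • (1 : Matrix n n ℝ))) =
      bottomEigenvalue (Matrix.toLin' A) + s := by
  have h : (A + s • (1 : Matrix n n ℝ)).IsHermitian := by
    simpa using hA.sub_smul_one (-s)
  refine eq_of_forall_le_iff fun b => ?_
  rw [h.le_bottomEigenvalue_iff, ← sub_le_iff_le_add, hA.le_bottomEigenvalue_iff]
  congr! 1
  module

theorem Matrix.IsHermitian.topEigenvalue_add_smul_one [Nonempty n] {A : Matrix n n ℝ}
    (hA : A.IsHermitian) (s : ℝ) :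
    topEigenvalue (Matrix.toLin' (A + s • (1 : Matrix n n ℝ))) =
      topEigenvalue (Matrix.toLin' A) + s := by
  have h : (A + s • (1 : Matrix n n ℝ)).IsHermitian := by
    simpa using hA.sub_smul_one (-s)
  refine eq_of_forall_ge_iff fun b => ?_
  rw [h.topEigenvalue_le_iff, ← le_sub_iff_add_le, hA.topEigenvalue_le_iff]
  congr! 1
  module

theorem Matrix.IsHermitian.topEigenvalue_le_iff_sum [Nonempty n] {A : Matrix n n ℝ}
    (hA : A.IsHermitian) {b : ℝ} :
    topEigenvalue (Matrix.toLin' A) ≤ b ↔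
      ∀ u : n → ℝ, ∑ i, ∑ j, A i j * (u i * u j) ≤ b * ∑ i, u i ^ 2 := by
  have h : (b • (1 : Matrix n n ℝ) - A).IsHermitian := by
    simpa using (hA.sub_smul_one b).neg
  rw [hA.topEigenvalue_le_iff, posSemidef_iff_dotProduct_mulVec, and_iff_right h]
  refine forall_congr' fun u => ?_
  rw [sub_mulVec, dotProduct_sub, sub_nonneg, dotProduct_mulVec_eq_sum A, smul_mulVec, one_mulVec,
    dotProduct_smul, smul_eq_mul]
  simp only [dotProduct, Pi.star_apply, star_trivial, sq]

/-- The symmetric matrices with smallest eigenvalue at least `b` form a closed set. They are taken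
in the function space, which carries the Borel structure that `Matrix` lacks. -/
theorem Matrix.isClosed_setOf_posSemidef_sub (b : ℝ) :
    IsClosed {A : n → n → ℝ | (Matrix.of A - b • (1 : Matrix n n ℝ)).PosSemidef} := by
  simp only [posSemidef_iff_dotProduct_mulVec, Set.ofPred_and, Set.ofPred_forall,
    Matrix.IsHermitian]
  refine IsClosed.inter (isClosed_eq (by fun_prop) (by fun_prop))
    (isClosed_iInter fun u => isClosed_le continuous_const ?_)
  simp only [dotProduct_mulVec_eq_sum]
  fun_prop

end matrix

/-! ### Gram matrices of a positive semi-definite kernel -/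

section gram
variable {χ : Type*} {k : χ → χ → ℝ}

theorem gramMatrix_isHermitian (hsymm : ∀ x y, k x y = k y x) (x : ℕ → χ) (m : ℕ) :
    (gramMatrix k x m).IsHermitian := by
  ext i j
  simp [gramMatrix, hsymm (x i)]

theorem gramMatrix_posSemidef (hpsd : (Matrix.of k : Matrix χ χ ℝ).PosSemidef) (x : ℕ → χ)
    (m : ℕ) : (gramMatrix k x m).PosSemidef :=
  hpsd.submatrix fun i : Fin m => x i

theorem gramMatrix_sum_nonneg (hpsd : (Matrix.of k : Matrix χ χ ℝ).PosSemidef) (x : ℕ → χ)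
    (m : ℕ) (u : Fin m → ℝ) : 0 ≤ ∑ i, ∑ j, gramMatrix k x m i j * (u i * u j) := by
  rw [← Matrix.dotProduct_mulVec_eq_sum]
  exact (gramMatrix_posSemidef hpsd x m).dotProduct_mulVec_nonneg u

/-- A positive semi-definite kernel with bounded diagonal is bounded, by positivity on two
points. -/
theorem abs_le_of_posSemidef (hpsd : (Matrix.of k : Matrix χ χ ℝ).PosSemidef)
    (hsymm : ∀ x y, k x y = k y x) {B : ℝ} (hB : ∀ x, |k x x| ≤ B) (x y : χ) : |k x y| ≤ B := by
  have h : ∀ c : ℝ, 0 ≤ k x x + 2 * c * k x y + c ^ 2 * k y y := fun c => by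
    have := gramMatrix_sum_nonneg hpsd (fun i => if i = 0 then x else y) 2 ![1, c]
    simp [gramMatrix, Fin.sum_univ_two] at this
    rw [hsymm y x] at this
    linarith
  have h1 := h 1
  have h2 := h (-1)
  have h3 := (abs_le.1 (hB x)).2
  have h4 := (abs_le.1 (hB y)).2
  rw [abs_le]
  constructor <;> linarith

/-- By interlacing, the smallest eigenvalue of the Gram matrix is nonincreasing in the number of
points. -/
theorem bottomEigenvalue_gramMatrix_succ_le (hsymm : ∀ x y, k x y = k y x) (x : ℕ → χ) (m : ℕ) :
    bottomEigenvalue (Matrix.toLin' (gramMatrix k x (m + 2))) ≤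
      bottomEigenvalue (Matrix.toLin' (gramMatrix k x (m + 1))) := by
  rw [(gramMatrix_isHermitian hsymm x _).le_bottomEigenvalue_iff]
  have h := ((gramMatrix_isHermitian hsymm x (m + 2)).le_bottomEigenvalue_iff.1 le_rfl).submatrix
    (Fin.castSucc : Fin (m + 1) → Fin (m + 2))
  convert h using 1
  ext i j
  simp [gramMatrix, Matrix.one_apply]

theorem bottomEigenvalue_gramMatrix_nonneg (hpsd : (Matrix.of k : Matrix χ χ ℝ).PosSemidef)
    (x : ℕ → χ) (m : ℕ) :
    0 ≤ bottomEigenvalue (Matrix.toLin' (gramMatrix k x (m + 1))) := by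
  rw [(gramMatrix_posSemidef hpsd x _).1.le_bottomEigenvalue_iff]
  simpa using gramMatrix_posSemidef hpsd x _

theorem measurable_bottomEigenvalue_gramMatrix {Ω : Type*} [MeasurableSpace Ω]
    [MeasurableSpace χ] (hmeas : Measurable (Function.uncurry k)) (hsymm : ∀ x y, k x y = k y x)
    {X : ℕ → Ω → χ} (hX : ∀ i, Measurable (X i)) (m : ℕ) :
    Measurable fun ω =>
      bottomEigenvalue (Matrix.toLin' (gramMatrix k (fun i => X i ω) (m + 1))) := by
  refine measurable_of_Ici fun b => ?_
  have h : Measurable fun ω => (fun i j => k (X i ω) (X j ω) : Fin (m + 1) → Fin (m + 1) → ℝ) :=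
    measurable_pi_iff.2 fun i => measurable_pi_iff.2 fun j =>
      hmeas.comp ((hX i).prodMk (hX j))
  convert h (Matrix.isClosed_setOf_posSemidef_sub (n := Fin (m + 1)) b).measurableSet using 1
  ext ω
  exact (gramMatrix_isHermitian hsymm (fun i => X i ω) _).le_bottomEigenvalue_iff

/-- The smallest eigenvalues of the growing Gram matrices converge, to a measurable non-negative
limit. -/
theorem exists_tendsto_bottomEigenvalue_gramMatrix {Ω : Type*} [MeasurableSpace Ω]
    [MeasurableSpace χ] (hmeas : Measurable (Function.uncurry k)) (hsymm : ∀ x y, k x y = k y x)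
    (hpsd : (Matrix.of k : Matrix χ χ ℝ).PosSemidef)
    {X : ℕ → Ω → χ} (hX : ∀ i, Measurable (X i)) :
    ∃ C : Ω → ℝ, Measurable C ∧ (∀ ω, 0 ≤ C ω) ∧
      ∀ ω, Tendsto (fun m : ℕ =>
          bottomEigenvalue (Matrix.toLin' (gramMatrix k (fun i => X i ω) m)))
        atTop (𝓝 (C ω)) := by
  have hlim : ∀ ω, Tendsto (fun m : ℕ =>
      bottomEigenvalue (Matrix.toLin' (gramMatrix k (fun i => X i ω) (m + 1)))) atTop
      (𝓝 (⨅ m : ℕ,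
        bottomEigenvalue (Matrix.toLin' (gramMatrix k (fun i => X i ω) (m + 1))))) := fun ω =>
    tendsto_atTop_ciInf
      (antitone_nat_of_succ_le fun m => bottomEigenvalue_gramMatrix_succ_le hsymm _ m)
      ⟨0, by rintro _ ⟨m, rfl⟩; exact bottomEigenvalue_gramMatrix_nonneg hpsd _ m⟩
  refine ⟨fun ω => ⨅ m : ℕ,
    bottomEigenvalue (Matrix.toLin' (gramMatrix k (fun i => X i ω) (m + 1))), ?_, fun ω => ?_,
    fun ω => (tendsto_add_atTop_iff_nat 1).1 (hlim ω)⟩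
  · exact measurable_of_tendsto_metrizable
      (fun m => measurable_bottomEigenvalue_gramMatrix hmeas hsymm hX m)
      (tendsto_pi_nhds.2 hlim)
  · exact le_ciInf fun m => bottomEigenvalue_gramMatrix_nonneg hpsd _ m

end gram

/-! ### The strong law of large numbers for V-statistics -/

section vstat
variable {χ Ω : Type*} [MeasurableSpace χ] [MeasurableSpace Ω] {μ : Measure χ}
  {P : Measure Ω} [IsProbabilityMeasure P] {X : ℕ → Ω → χ}

theorem integral_comp_pair (hX : ∀ i, Measurable (X i)) (hlaw : ∀ i, P.map (X i) = μ)
    (hindep : iIndepFun X P) {g : χ × χ → ℝ} (hg : Measurable g) {i j : ℕ} (hij : i ≠ j) :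
    ∫ ω, g (X i ω, X j ω) ∂P = ∫ p, g p ∂(μ.prod μ) := by
  have h := (indepFun_iff_map_prod_eq_prod_map_map (hX i).aemeasurable (hX j).aemeasurable).1
    (hindep.indepFun hij)
  rw [hlaw, hlaw] at h
  rw [← h, integral_map ((hX i).prodMk (hX j)).aemeasurable hg.aestronglyMeasurable]

/-- Pairs with disjoint index sets are uncorrelated. -/
theorem integral_mul_comp_pair_eq_zero (hX : ∀ i, Measurable (X i))
    (hlaw : ∀ i, P.map (X i) = μ) (hindep : iIndepFun X P) {g : χ × χ → ℝ} (hg : Measurable g)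
    (h0 : ∫ p, g p ∂(μ.prod μ) = 0) {i j k l : ℕ} (hij : i ≠ j) (hik : i ≠ k) (hil : i ≠ l)
    (hjk : j ≠ k) (hjl : j ≠ l) :
    ∫ ω, g (X i ω, X j ω) * g (X k ω, X l ω) ∂P = 0 := by
  have h := (hindep.indepFun_prodMk_prodMk hX i j k l hik hil hjk hjl).comp hg hg
  have h' := h.integral_mul_eq_mul_integral
    (hg.comp ((hX i).prodMk (hX j))).aestronglyMeasurable
    (hg.comp ((hX k).prodMk (hX l))).aestronglyMeasurable
  have h1 := integral_comp_pair hX hlaw hindep hg hij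
  simp only [Pi.mul_apply, Function.comp_apply] at h'
  rw [h', h1, h0, zero_mul]

/-- The second moment of a centered V-statistic of size `m` is of order `m ^ 3`: among the `m ^ 4`
products of two pairs, only those with a coincidence among the four indices contribute. -/
theorem integral_sq_sum_pair_le (hX : ∀ i, Measurable (X i)) (hlaw : ∀ i, P.map (X i) = μ)
    (hindep : iIndepFun X P) {g : χ × χ → ℝ} (hg : Measurable g)
    (h0 : ∫ p, g p ∂(μ.prod μ) = 0) {D : ℝ} (hD : ∀ p, |g p| ≤ D) (m : ℕ) :
    ∫ ω, (∑ p ∈ Finset.range m ×ˢ Finset.range m, g (X p.1 ω, X p.2 ω)) ^ 2 ∂P ≤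
      5 * D ^ 2 * (m : ℝ) ^ 3 := by
  have hmeas : ∀ i j, Measurable fun ω => g (X i ω, X j ω) := fun i j =>
    hg.comp ((hX i).prodMk (hX j))
  have hbd : ∀ i j k l ω, |g (X i ω, X j ω) * g (X k ω, X l ω)| ≤ D ^ 2 := fun i j k l ω => by
    rw [abs_mul, sq]
    exact mul_le_mul (hD _) (hD _) (abs_nonneg _) ((abs_nonneg _).trans (hD (X i ω, X j ω)))
  have hint : ∀ i j k l, Integrable (fun ω => g (X i ω, X j ω) * g (X k ω, X l ω)) P :=
    fun i j k l => Integrable.of_bound ((hmeas i j).mul (hmeas k l)).aestronglyMeasurable (D ^ 2)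
      (Eventually.of_forall fun ω => hbd i j k l ω)
  have hterm : ∀ p q : ℕ × ℕ, ∫ ω, g (X p.1 ω, X p.2 ω) * g (X q.1 ω, X q.2 ω) ∂P ≤
      D ^ 2 * ((if p.1 = q.1 then 1 else 0) + (if p.1 = q.2 then 1 else 0) +
        (if p.2 = q.1 then 1 else 0) + (if p.2 = q.2 then 1 else 0) +
        (if p.1 = p.2 then 1 else 0)) := by
    rintro ⟨i, j⟩ ⟨k, l⟩
    by_cases h : i ≠ j ∧ i ≠ k ∧ i ≠ l ∧ j ≠ k ∧ j ≠ l
    · obtain ⟨h1, h2, h3, h4, h5⟩ := h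
      simp only [integral_mul_comp_pair_eq_zero hX hlaw hindep hg h0 h1 h2 h3 h4 h5]
      simp [h1, h2, h3, h4, h5]
    · have hle : ∫ ω, g (X i ω, X j ω) * g (X k ω, X l ω) ∂P ≤ D ^ 2 := by
        have := integral_mono (hint i j k l) (integrable_const (D ^ 2))
          fun ω => (le_abs_self _).trans (hbd i j k l ω)
        simpa using this
      refine hle.trans (le_mul_of_one_le_right (sq_nonneg D) ?_)
      dsimp only
      split_ifs <;> first | (norm_num; done) | grind
  have hcount : ∑ p ∈ Finset.range m ×ˢ Finset.range m, ∑ q ∈ Finset.range m ×ˢ Finset.range m,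
      D ^ 2 * ((if p.1 = q.1 then (1 : ℝ) else 0) + (if p.1 = q.2 then 1 else 0) +
        (if p.2 = q.1 then 1 else 0) + (if p.2 = q.2 then 1 else 0) +
        (if p.1 = p.2 then 1 else 0)) = 5 * D ^ 2 * (m : ℝ) ^ 3 := by
    simp only [← Finset.mul_sum, Finset.sum_product, Finset.sum_range, Finset.sum_add_distrib]
    simp only [Fin.val_inj, Finset.sum_const, Finset.sum_ite_eq,
      Finset.mem_univ, if_true, Finset.card_univ, Fintype.card_fin, nsmul_eq_mul, mul_one,
      ← Finset.mul_sum]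
    ring
  simp only [sq, Finset.sum_mul_sum]
  rw [integral_finsetSum _ fun p _ => integrable_finsetSum _ fun q _ => hint _ _ _ _]
  rw [← sq, ← hcount]
  refine Finset.sum_le_sum fun p _ => ?_
  rw [integral_finsetSum _ fun q _ => hint _ _ _ _]
  exact Finset.sum_le_sum fun q _ => hterm p q

/-- Along the squares, a centered V-statistic tends to zero almost surely. -/
theorem ae_tendsto_sum_pair_sq (hX : ∀ i, Measurable (X i)) (hlaw : ∀ i, P.map (X i) = μ)
    (hindep : iIndepFun X P) {g : χ × χ → ℝ} (hg : Measurable g)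
    (h0 : ∫ p, g p ∂(μ.prod μ) = 0) {D : ℝ} (hD : ∀ p, |g p| ≤ D) :
    ∀ᵐ ω ∂P, Tendsto (fun n : ℕ =>
      (∑ p ∈ Finset.range (n ^ 2) ×ˢ Finset.range (n ^ 2), g (X p.1 ω, X p.2 ω)) / (n : ℝ) ^ 4)
      atTop (𝓝 0) := by
  set F : ℕ → Ω → ℝ := fun n ω =>
    (∑ p ∈ Finset.range (n ^ 2) ×ˢ Finset.range (n ^ 2), g (X p.1 ω, X p.2 ω)) / (n : ℝ) ^ 4
    with hF
  have hmeas : ∀ n, Measurable (F n) := fun n =>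
    (Finset.measurable_sum _ fun p _ => hg.comp ((hX p.1).prodMk (hX p.2))).div_const _
  have hbd : ∀ n ω, |F n ω| ≤
      (∑ p ∈ Finset.range (n ^ 2) ×ˢ Finset.range (n ^ 2), D) / (n : ℝ) ^ 4 := by
    intro n ω
    rw [hF]
    simp only [abs_div, abs_pow, Nat.abs_cast]
    gcongr
    exact (Finset.abs_sum_le_sum_abs _ _).trans (Finset.sum_le_sum fun p _ => hD _)
  have hint : ∀ n, Integrable (fun ω => F n ω ^ 2) P := fun n =>
    Integrable.of_bound ((hmeas n).pow_const 2).aestronglyMeasurable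
      (((∑ p ∈ Finset.range (n ^ 2) ×ˢ Finset.range (n ^ 2), D) / (n : ℝ) ^ 4) ^ 2)
      (Eventually.of_forall fun ω => by
        rw [Real.norm_eq_abs, abs_pow]
        exact pow_le_pow_left₀ (abs_nonneg _) (hbd n ω) 2)
  have hle : ∀ n, ∫ ω, F n ω ^ 2 ∂P ≤ 5 * D ^ 2 * (1 / (n : ℝ) ^ 2) := fun n => by
    have h := integral_sq_sum_pair_le hX hlaw hindep hg h0 hD (n ^ 2)
    simp only [hF, div_pow, integral_div]
    rcases Nat.eq_zero_or_pos n with rfl | hn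
    · simp
    have hn' : (0 : ℝ) < n := by exact_mod_cast hn
    rw [div_le_iff₀ (by positivity)]
    refine h.trans (le_of_eq ?_)
    push_cast
    field_simp
  have hsum : ∑' n, ∫⁻ ω, ENNReal.ofReal (F n ω ^ 2) ∂P ≠ ⊤ := by
    have hs : Summable fun n : ℕ => 5 * D ^ 2 * (1 / (n : ℝ) ^ 2) :=
      (Real.summable_one_div_nat_pow.2 one_lt_two).mul_left _
    refine ne_top_of_le_ne_top hs.tsum_ofReal_ne_top (ENNReal.tsum_le_tsum fun n => ?_)
    rw [← ofReal_integral_eq_lintegral_ofReal (hint n)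
      (Eventually.of_forall fun ω => sq_nonneg _)]
    exact ENNReal.ofReal_le_ofReal (hle n)
  rw [← lintegral_tsum fun n => ((hmeas n).pow_const 2).ennreal_ofReal.aemeasurable] at hsum
  filter_upwards [ae_lt_top (Measurable.tsum fun n =>
    ((hmeas n).pow_const 2).ennreal_ofReal) hsum] with ω hω
  have h1 := ENNReal.tendsto_atTop_zero_of_tsum_ne_top hω.ne
  have h2 := (ENNReal.tendsto_toReal ENNReal.zero_ne_top).comp h1
  simp only [Function.comp_def, ENNReal.toReal_ofReal (sq_nonneg _), ENNReal.toReal_zero] at h2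
  have h3 := h2.sqrt
  simp only [Real.sqrt_sq_eq_abs, Real.sqrt_zero] at h3
  exact (tendsto_zero_iff_abs_tendsto_zero _).2 h3

theorem tendsto_nat_sqrt_atTop : Tendsto Nat.sqrt atTop atTop :=
  tendsto_atTop.2 fun b => (eventually_ge_atTop (b * b)).mono fun _ hm => Nat.le_sqrt.2 hm

/-- Bounded double sums that vanish asymptotically along the squares do so along all integers. -/
theorem tendsto_sum_pair_of_sq {h : ℕ × ℕ → ℝ} {D : ℝ} (hD : ∀ p, |h p| ≤ D)
    (hsq : Tendsto (fun n : ℕ =>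
      (∑ p ∈ Finset.range (n ^ 2) ×ˢ Finset.range (n ^ 2), h p) / (n : ℝ) ^ 4) atTop (𝓝 0)) :
    Tendsto (fun m : ℕ => (∑ p ∈ Finset.range m ×ˢ Finset.range m, h p) / (m : ℝ) ^ 2)
      atTop (𝓝 0) := by
  have hD0 : 0 ≤ D := (abs_nonneg _).trans (hD (0, 0))
  have hlim : Tendsto (fun n : ℕ =>
      |(∑ p ∈ Finset.range (n ^ 2) ×ˢ Finset.range (n ^ 2), h p) / (n : ℝ) ^ 4| +
        8 * D * (1 / (n : ℝ))) atTop (𝓝 0) := by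
    simpa using hsq.abs.add (tendsto_one_div_atTop_nhds_zero_nat.const_mul (8 * D))
  refine squeeze_zero_norm' ?_ (hlim.comp tendsto_nat_sqrt_atTop)
  filter_upwards [eventually_ge_atTop 1] with m hm
  -- With `n = ⌊√m⌋` the gap `m ^ 2 - n ^ 4` is `O(n ^ 3)`, hence negligible against `m ^ 2`.
  set n := Nat.sqrt m with hn
  have hn1 : 1 ≤ n := Nat.le_sqrt.2 hm
  have hnm : n ^ 2 ≤ m := Nat.sqrt_le' m
  have hmn : m ≤ n ^ 2 + 2 * n := by
    have := Nat.lt_succ_sqrt' m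
    rw [← hn, Nat.succ_eq_add_one] at this
    nlinarith
  have hsub : Finset.range (n ^ 2) ×ˢ Finset.range (n ^ 2) ⊆ Finset.range m ×ˢ Finset.range m :=
    Finset.product_subset_product (Finset.range_subset_range.2 hnm)
      (Finset.range_subset_range.2 hnm)
  have hn0 : (1 : ℝ) ≤ n := by exact_mod_cast hn1
  have hnmR : (n : ℝ) ^ 2 ≤ m := by exact_mod_cast hnm
  have hmnR : (m : ℝ) ≤ n ^ 2 + 2 * n := by exact_mod_cast hmn
  have hcard : ((Finset.range m ×ˢ Finset.range m \
      Finset.range (n ^ 2) ×ˢ Finset.range (n ^ 2)).card : ℝ) = (m : ℝ) ^ 2 - (n : ℝ) ^ 4 := by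
    rw [Finset.cast_card_sdiff hsub]
    simp
    ring
  have hrest : |∑ p ∈ Finset.range m ×ˢ Finset.range m \
      Finset.range (n ^ 2) ×ˢ Finset.range (n ^ 2), h p| ≤ ((m : ℝ) ^ 2 - (n : ℝ) ^ 4) * D := by
    rw [← hcard, ← nsmul_eq_mul]
    exact (Finset.abs_sum_le_sum_abs _ _).trans (Finset.sum_le_card_nsmul _ _ _ fun p _ => hD p)
  have hn4 : (n : ℝ) ^ 4 ≤ (m : ℝ) ^ 2 := by nlinarith [sq_nonneg (n : ℝ)]
  have hgap : (m : ℝ) ^ 2 - (n : ℝ) ^ 4 ≤ 8 * (n : ℝ) ^ 3 := by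
    have : (m : ℝ) ^ 2 ≤ ((n : ℝ) ^ 2 + 2 * n) ^ 2 := by gcongr
    nlinarith [mul_nonneg (sq_nonneg (n : ℝ)) (sub_nonneg.2 hn0)]
  have hpos : (0 : ℝ) < (n : ℝ) ^ 4 := by positivity
  rw [← Finset.sum_sdiff hsub, Real.norm_eq_abs, abs_div, abs_of_nonneg (sq_nonneg (m : ℝ)),
    Function.comp_apply, abs_div, abs_of_pos hpos]
  calc _ ≤ _ / (n : ℝ) ^ 4 := div_le_div_of_nonneg_left (abs_nonneg _) hpos hn4
    _ ≤ (8 * (n : ℝ) ^ 3 * D +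
        |∑ p ∈ Finset.range (n ^ 2) ×ˢ Finset.range (n ^ 2), h p|) / (n : ℝ) ^ 4 := by
      gcongr
      refine (abs_add_le _ _).trans (add_le_add (hrest.trans ?_) le_rfl)
      gcongr
    _ = _ := by
      field_simp
      ring

/-- Strong law of large numbers for V-statistics of order two with a bounded kernel. -/
theorem ae_tendsto_vStatistic [IsProbabilityMeasure μ] (hX : ∀ i, Measurable (X i))
    (hlaw : ∀ i, P.map (X i) = μ) (hindep : iIndepFun X P) {g : χ × χ → ℝ} (hg : Measurable g)
    {D : ℝ} (hD : ∀ p, |g p| ≤ D) :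
    ∀ᵐ ω ∂P, Tendsto (fun m : ℕ =>
      (∑ i : Fin m, ∑ j : Fin m, g (X i ω, X j ω)) / (m : ℝ) ^ 2) atTop
      (𝓝 (∫ p, g p ∂(μ.prod μ))) := by
  set θ := ∫ p, g p ∂(μ.prod μ) with hθ
  have hgi : Integrable g (μ.prod μ) :=
    Integrable.of_bound hg.aestronglyMeasurable D (Eventually.of_forall hD)
  have hD' : ∀ p, |g p - θ| ≤ D + |θ| := fun p =>
    (abs_sub _ _).trans (add_le_add (hD p) le_rfl)
  have h0 : ∫ p, g p - θ ∂(μ.prod μ) = 0 := by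
    rw [integral_sub hgi (integrable_const _)]
    simp [hθ]
  filter_upwards [ae_tendsto_sum_pair_sq hX hlaw hindep (hg.sub_const θ) h0 hD'] with ω hω
  have h := tendsto_sum_pair_of_sq (h := fun p : ℕ × ℕ => g (X p.1 ω, X p.2 ω) - θ)
    (fun p => hD' _) hω
  have h' := h.add_const θ
  rw [zero_add] at h'
  refine h'.congr' ?_
  filter_upwards [eventually_ge_atTop 1] with m hm
  have hm' : (0 : ℝ) < m := by exact_mod_cast hm
  have e : ∑ i : Fin m, ∑ j : Fin m, g (X i ω, X j ω) =
      ∑ p ∈ Finset.range m ×ˢ Finset.range m, g (X p.1 ω, X p.2 ω) := by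
    rw [Finset.sum_product, ← Fin.sum_univ_eq_sum_range
      (fun i => ∑ j ∈ Finset.range m, g (X i ω, X j ω)) m]
    refine Finset.sum_congr rfl fun i _ => ?_
    exact Fin.sum_univ_eq_sum_range (fun j => g (X i ω, X j ω)) m
  rw [e, Finset.sum_sub_distrib]
  simp only [Finset.sum_const, Finset.card_product, Finset.card_range, nsmul_eq_mul]
  push_cast
  field_simp
  ring

/-- Strong law of large numbers for bounded functions of the sample. -/
theorem ae_tendsto_average (hX : ∀ i, Measurable (X i)) (hlaw : ∀ i, P.map (X i) = μ)
    (hindep : iIndepFun X P) {f : χ → ℝ} (hf : Measurable f) {D : ℝ} (hD : ∀ x, |f x| ≤ D) :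
    ∀ᵐ ω ∂P, Tendsto (fun m : ℕ => (∑ i : Fin m, f (X i ω)) / (m : ℝ)) atTop
      (𝓝 (∫ x, f x ∂μ)) := by
  have h := strong_law_ae_real (μ := P) (fun i ω => f (X i ω))
    (Integrable.of_bound (hf.comp (hX 0)).aestronglyMeasurable D
      (Eventually.of_forall fun ω => hD _))
    (fun i j hij => (hindep.indepFun hij).comp hf hf)
    (fun i => IdentDistrib.comp ⟨(hX i).aemeasurable, (hX 0).aemeasurable,
      by rw [hlaw, hlaw]⟩ hf)
  have e : ∫ ω, f (X 0 ω) ∂P = ∫ x, f x ∂μ := by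
    rw [← hlaw 0, integral_map (hX 0).aemeasurable hf.aestronglyMeasurable]
  simp only [← Fin.sum_univ_eq_sum_range (fun i => f (X i _)), e] at h
  exact h

end vstat

/-! ### Density of step kernels -/

section step
variable {χ : Type*} [MeasurableSpace χ]

/-- A kernel that depends on its two arguments through the classes of a finite measurable
partition only. The partition is encoded as a simple function `Φ` with values in `ℕ`. -/
def IsStepKernel (s : χ × χ → ℝ) : Prop :=
  ∃ (Φ : SimpleFunc χ ℕ) (c : ℕ → ℕ → ℝ), s = fun p => c (Φ p.1) (Φ p.2)

theorem IsStepKernel.measurable {s : χ × χ → ℝ} (hs : IsStepKernel s) : Measurable s := by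
  obtain ⟨Φ, c, rfl⟩ := hs
  exact (measurable_of_countable (Function.uncurry c)).comp
    ((Φ.measurable.comp measurable_fst).prodMk (Φ.measurable.comp measurable_snd))

theorem IsStepKernel.bounded {s : χ × χ → ℝ} (hs : IsStepKernel s) :
    ∃ D, ∀ p, |s p| ≤ D := by
  obtain ⟨Φ, c, rfl⟩ := hs
  refine ⟨∑ a ∈ Φ.range, ∑ b ∈ Φ.range, |c a b|, fun p => ?_⟩
  exact (Finset.single_le_sum (f := fun b => |c (Φ p.1) b|) (fun b _ => abs_nonneg _)
    (Φ.mem_range_self p.2)).trans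
    (Finset.single_le_sum (f := fun a => ∑ b ∈ Φ.range, |c a b|)
      (fun a _ => Finset.sum_nonneg fun b _ => abs_nonneg _) (Φ.mem_range_self p.1))

theorem IsStepKernel.add {s t : χ × χ → ℝ} (hs : IsStepKernel s) (ht : IsStepKernel t) :
    IsStepKernel (s + t) := by
  obtain ⟨Φ, c, rfl⟩ := hs
  obtain ⟨Ψ, d, rfl⟩ := ht
  refine ⟨(Φ.pair Ψ).map fun q => Nat.pair q.1 q.2,
    fun a b => c a.unpair.1 b.unpair.1 + d a.unpair.2 b.unpair.2, ?_⟩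
  ext p
  simp

/-- The sets whose indicator is a step kernel: finite unions of rectangles. -/
def stepSets (χ : Type*) [MeasurableSpace χ] : Set (Set (χ × χ)) :=
  {E | ∃ (Φ : SimpleFunc χ ℕ) (S : Set (ℕ × ℕ)), E = {p | (Φ p.1, Φ p.2) ∈ S}}

theorem exists_common_stepSets {E F : Set (χ × χ)} (hE : E ∈ stepSets χ) (hF : F ∈ stepSets χ) :
    ∃ (Φ : SimpleFunc χ ℕ) (S T : Set (ℕ × ℕ)), E = {p | (Φ p.1, Φ p.2) ∈ S} ∧
      F = {p | (Φ p.1, Φ p.2) ∈ T} := by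
  obtain ⟨Φ, S, rfl⟩ := hE
  obtain ⟨Ψ, T, rfl⟩ := hF
  refine ⟨(Φ.pair Ψ).map fun q => Nat.pair q.1 q.2,
    {p | (p.1.unpair.1, p.2.unpair.1) ∈ S}, {p | (p.1.unpair.2, p.2.unpair.2) ∈ T}, ?_, ?_⟩ <;>
  · ext p
    simp

theorem isSetRing_stepSets : IsSetRing (stepSets χ) where
  empty_mem := ⟨SimpleFunc.const χ 0, ∅, by ext; simp⟩
  union_mem E F hE hF := by
    obtain ⟨Φ, S, T, rfl, rfl⟩ := exists_common_stepSets hE hF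
    exact ⟨Φ, S ∪ T, by ext; simp⟩
  sdiff_mem E F hE hF := by
    obtain ⟨Φ, S, T, rfl, rfl⟩ := exists_common_stepSets hE hF
    exact ⟨Φ, S \ T, by ext; simp⟩

theorem isStepKernel_indicator {E : Set (χ × χ)} (hE : E ∈ stepSets χ) (c : ℝ) :
    IsStepKernel (E.indicator fun _ => c) := by
  classical
  obtain ⟨Φ, S, rfl⟩ := hE
  refine ⟨Φ, fun a b => if (a, b) ∈ S then c else 0, ?_⟩
  ext p
  simp [Set.indicator_apply]

theorem measurableSet_of_mem_stepSets {E : Set (χ × χ)} (hE : E ∈ stepSets χ) :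
    MeasurableSet E := by
  obtain ⟨Φ, S, rfl⟩ := hE
  exact ((Φ.measurable.comp measurable_fst).prodMk (Φ.measurable.comp measurable_snd))
    S.to_countable.measurableSet

theorem prod_mem_stepSets {A B : Set χ} (hA : MeasurableSet A) (hB : MeasurableSet B) :
    A ×ˢ B ∈ stepSets χ := by
  classical
  refine ⟨(SimpleFunc.piecewise A hA (SimpleFunc.const χ 1) (SimpleFunc.const χ 0)).pair
    (SimpleFunc.piecewise B hB (SimpleFunc.const χ 1) (SimpleFunc.const χ 0)) |>.map
      fun q => Nat.pair q.1 q.2, {p | p.1.unpair.1 = 1 ∧ p.2.unpair.2 = 1}, ?_⟩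
  ext p
  simp [Set.piecewise]

theorem generateFrom_stepSets :
    (inferInstance : MeasurableSpace (χ × χ)) = MeasurableSpace.generateFrom (stepSets χ) := by
  refine le_antisymm ?_ (MeasurableSpace.generateFrom_le fun E => measurableSet_of_mem_stepSets)
  rw [← generateFrom_prod]
  refine MeasurableSpace.generateFrom_mono ?_
  rintro _ ⟨A, hA, B, hB, rfl⟩
  exact prod_mem_stepSets hA hB

/-- Step kernels are dense in `L²(μ ⊗ μ)`. -/
theorem exists_isStepKernel_eLpNorm_sub_le {μ : Measure χ} [IsFiniteMeasure μ]
    {g : χ × χ → ℝ} (hg : MemLp g 2 (μ.prod μ)) {ε : ENNReal} (hε : ε ≠ 0) :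
    ∃ s, eLpNorm (g - s) 2 (μ.prod μ) ≤ ε ∧ IsStepKernel s := by
  refine MemLp.induction_dense (by simp) IsStepKernel (fun c E hE _ ε hε => ?_)
    (fun s t => IsStepKernel.add) (fun s hs => hs.measurable.aestronglyMeasurable) hg hε
  obtain ⟨η, hη, h⟩ := exists_eLpNorm_indicator_le (μ := μ.prod μ) (p := 2) (by simp) c hε
  obtain ⟨t, ht, hlt⟩ := exists_measure_symmDiff_lt_of_generateFrom_isSetRing (μ := μ.prod μ)
    isSetRing_stepSets
    ⟨{Set.univ}, Set.countable_singleton _, by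
      simpa using prod_mem_stepSets (χ := χ) MeasurableSet.univ MeasurableSet.univ, by simp⟩
    generateFrom_stepSets hE (ε := η) (by exact_mod_cast hη)
  refine ⟨t.indicator fun _ => c, ?_, isStepKernel_indicator ht c⟩
  refine le_trans (eLpNorm_mono fun p => ?_) (h (symmDiff t E) hlt.le)
  by_cases h1 : p ∈ t <;> by_cases h2 : p ∈ E <;> simp [Set.mem_symmDiff, h1, h2]

end step

/-! ### Largest eigenvalues of compact symmetric operators -/

section spectral
variable {H : Type*} [NormedAddCommGroup H] [InnerProductSpace ℝ H]

/-- Cauchy–Schwarz for the form of a positive operator `S`, applied to `x` and `S x`. -/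
theorem norm_sq_le_of_form_nonneg {S : H →L[ℝ] H} (hS : (S : H →ₗ[ℝ] H).IsSymmetric)
    (hpos : ∀ x, 0 ≤ inner ℝ (S x) x) (x : H) : ‖S x‖ ^ 2 ≤ ‖S‖ * inner ℝ (S x) x := by
  rcases eq_or_lt_of_le (norm_nonneg S) with h0 | h0
  · have : S = 0 := norm_eq_zero.1 h0.symm
    simp [this]
  -- Non-negativity of the form at `‖S‖ • x - S x` is the inequality, up to a factor `‖S‖`.
  have h := hpos (‖S‖ • x - S x)
  have hs : inner ℝ (S (S x)) x = ‖S x‖ ^ 2 := by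
    have := hS (S x) x
    simp only [ContinuousLinearMap.coe_coe] at this
    rw [this, real_inner_self_eq_norm_sq]
  have hb : inner ℝ (S (S x)) (S x) ≤ ‖S‖ * ‖S x‖ ^ 2 := by
    refine (real_inner_le_norm _ _).trans ?_
    have := mul_le_mul_of_nonneg_right (S.le_opNorm (S x)) (norm_nonneg (S x))
    linarith
  simp only [map_sub, map_smul, inner_sub_left, inner_sub_right, inner_smul_left,
    inner_smul_right, RCLike.conj_to_real, real_inner_self_eq_norm_sq, hs] at h
  refine le_of_mul_le_mul_left ?_ h0
  linarith

/-- If the quadratic form of a compact symmetric operator takes a positive value, then its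
supremum over the unit sphere is an eigenvalue. -/
theorem exists_hasEigenvalue_of_compact {T : H →L[ℝ] H} (hT : (T : H →ₗ[ℝ] H).IsSymmetric)
    (hc : IsCompactOperator T) {x₀ : H} (hx₀ : 0 < inner ℝ (T x₀) x₀) :
    ∃ M, 0 < M ∧ Module.End.HasEigenvalue (T : H →ₗ[ℝ] H) M ∧
      ∀ x, inner ℝ (T x) x ≤ M * ‖x‖ ^ 2 := by
  set A : Set ℝ := {r | ∃ x, ‖x‖ = 1 ∧ r = inner ℝ (T x) x} with hA
  have hbdd : BddAbove A := by
    refine ⟨‖T‖, ?_⟩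
    rintro r ⟨x, hx, rfl⟩
    refine (real_inner_le_norm _ _).trans ?_
    simpa [hx] using T.le_opNorm x
  have hscale : ∀ x : H, x ≠ 0 → inner ℝ (T x) x / ‖x‖ ^ 2 ∈ A := fun x hx => by
    have hx' : ‖x‖ ≠ 0 := norm_ne_zero_iff.2 hx
    refine ⟨‖x‖⁻¹ • x, by simp [norm_smul, hx'], ?_⟩
    simp only [map_smul, inner_smul_left, inner_smul_right, RCLike.conj_to_real]
    field_simp
  have hform : ∀ x, inner ℝ (T x) x ≤ sSup A * ‖x‖ ^ 2 := fun x => by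
    rcases eq_or_ne x 0 with rfl | hx
    · simp
    · have : 0 < ‖x‖ ^ 2 := by positivity
      exact (div_le_iff₀ this).1 (le_csSup hbdd (hscale x hx))
  have hx₀' : x₀ ≠ 0 := by
    rintro rfl
    simp at hx₀
  have hM : 0 < sSup A :=
    lt_of_lt_of_le (div_pos hx₀ (by positivity)) (le_csSup hbdd (hscale x₀ hx₀'))
  refine ⟨sSup A, hM, ?_, hform⟩
  by_contra hne
  obtain ⟨K, hK⟩ := hc.antilipschitz_of_not_hasEigenvalue hM.ne' hne
  set S : H →L[ℝ] H := sSup A • 1 - T with hS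
  have hSapp : ∀ x, S x = sSup A • x - T x := fun x => by simp [hS]
  have hSsymm : (S : H →ₗ[ℝ] H).IsSymmetric := fun x y => by
    have := hT x y
    simp only [ContinuousLinearMap.coe_coe] at this
    simp [hSapp, inner_sub_left, inner_sub_right, inner_smul_left, inner_smul_right, this]
  have hSform : ∀ x, inner ℝ (S x) x = sSup A * ‖x‖ ^ 2 - inner ℝ (T x) x := fun x => by
    simp [hSapp, inner_sub_left, inner_smul_left]
  have hSpos : ∀ x, 0 ≤ inner ℝ (S x) x := fun x => by
    rw [hSform]
    linarith [hform x]
  -- Unit vectors almost maximizing the form are almost eigenvectors.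
  have hkey : ∀ x, ‖x‖ = 1 → 1 ≤ (K : ℝ) ^ 2 * ‖S‖ * (sSup A - inner ℝ (T x) x) := fun x hx => by
    have h1 : ‖x‖ ≤ K * ‖S x‖ := by
      have := hK.le_mul_dist x 0
      rw [dist_zero_right, map_zero, dist_zero_right] at this
      refine this.trans (le_of_eq ?_)
      rw [hSapp, norm_sub_rev]
      simp
    have h2 := norm_sq_le_of_form_nonneg hSsymm hSpos x
    rw [hSform, hx] at h2
    rw [hx] at h1
    calc (1 : ℝ) ≤ (K * ‖S x‖) ^ 2 := one_le_pow₀ h1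
      _ = (K : ℝ) ^ 2 * ‖S x‖ ^ 2 := by ring
      _ ≤ (K : ℝ) ^ 2 * (‖S‖ * (sSup A * 1 ^ 2 - inner ℝ (T x) x)) := by gcongr
      _ = _ := by ring
  have hne' : A.Nonempty := ⟨_, hscale x₀ hx₀'⟩
  obtain ⟨_, ⟨x, hx, rfl⟩, hlt⟩ := exists_lt_of_lt_csSup hne'
    (sub_lt_self (sSup A) (show 0 < 1 / ((K : ℝ) ^ 2 * ‖S‖ + 1) by positivity))
  have h1 := hkey x hx
  have h2 : sSup A - inner ℝ (T x) x < 1 / ((K : ℝ) ^ 2 * ‖S‖ + 1) := by linarith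
  rw [lt_div_iff₀ (by positivity)] at h2
  have h3 : 0 ≤ sSup A - inner ℝ (T x) x := by
    have := hform x
    rw [hx] at this
    linarith
  nlinarith

end spectral

/-! ### The integral operator of a square integrable kernel -/

section operator
variable {χ : Type*} [MeasurableSpace χ] {μ : Measure χ} {k : χ → χ → ℝ}

theorem MeasureTheory.MemLp.tensor {f g : χ → ℝ} (hf : MemLp f 2 μ) (hg : MemLp g 2 μ) :
    MemLp (fun p : χ × χ => f p.1 * g p.2) 2 (μ.prod μ) := by
  have hm : AEStronglyMeasurable (fun p : χ × χ => f p.1 * g p.2) (μ.prod μ) :=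
    hf.1.comp_fst.mul hg.1.comp_snd
  rw [memLp_two_iff_integrable_sq hm]
  simp only [mul_pow]
  exact ((memLp_two_iff_integrable_sq hf.1).1 hf).mul_prod
    ((memLp_two_iff_integrable_sq hg.1).1 hg)

variable [IsProbabilityMeasure μ]

theorem kernelOperator_coeFn (hk : MemLp (Function.uncurry k) 2 (μ.prod μ)) (f : Lp ℝ 2 μ) :
    kernelOperator μ k hk f =ᵐ[μ] fun y => ∫ x, k x y * f x ∂μ :=
  MemLp.coeFn_toLp (kernel_integral_memLp hk (Lp.memLp f))

theorem inner_kernelOperator (hk : MemLp (Function.uncurry k) 2 (μ.prod μ)) (f g : Lp ℝ 2 μ) :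
    inner ℝ (kernelOperator μ k hk f) g = ∫ p, k p.1 p.2 * (f p.1 * g p.2) ∂(μ.prod μ) := by
  have hint : Integrable (fun p : χ × χ => k p.1 p.2 * (f p.1 * g p.2)) (μ.prod μ) :=
    hk.integrable_mul ((Lp.memLp f).tensor (Lp.memLp g))
  rw [integral_prod_symm _ hint, L2.inner_def]
  refine integral_congr_ae ?_
  filter_upwards [kernelOperator_coeFn hk f] with y hy
  simp only [RCLike.inner_apply, hy, RCLike.conj_to_real]
  rw [mul_comm, ← integral_mul_const]
  exact integral_congr_ae (Eventually.of_forall fun x => by ring)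

theorem kernelOperator_isSymmetric (hk : MemLp (Function.uncurry k) 2 (μ.prod μ))
    (hsymm : ∀ x y, k x y = k y x) : (kernelOperator μ k hk).IsSymmetric := fun f g => by
  rw [inner_kernelOperator, real_inner_comm, inner_kernelOperator,
    ← integral_prod_swap]
  refine integral_congr_ae (Eventually.of_forall fun p => ?_)
  simp only [Prod.fst_swap, Prod.snd_swap]
  rw [hsymm, mul_comm (f _)]

theorem MeasureTheory.Lp.integral_sq {α : Type*} [MeasurableSpace α] {ν : Measure α}
    (f : Lp ℝ 2 ν) : ∫ x, f x ^ 2 ∂ν = ‖f‖ ^ 2 := by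
  rw [← real_inner_self_eq_norm_sq, L2.inner_def]
  simp [sq]

/-- The form of the integral operator is bounded by the Hilbert–Schmidt norm of the kernel. -/
theorem abs_inner_kernelOperator_le (hk : MemLp (Function.uncurry k) 2 (μ.prod μ))
    (f g : Lp ℝ 2 μ) :
    |inner ℝ (kernelOperator μ k hk f) g| ≤
      (eLpNorm (Function.uncurry k) 2 (μ.prod μ)).toReal * (‖f‖ * ‖g‖) := by
  have ht := (Lp.memLp f).tensor (Lp.memLp g)
  have h1 : inner ℝ (kernelOperator μ k hk f) g = inner ℝ (hk.toLp _) (ht.toLp _) := by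
    rw [inner_kernelOperator, L2.inner_def]
    refine integral_congr_ae ?_
    filter_upwards [hk.coeFn_toLp, ht.coeFn_toLp] with p hp hq
    simp [hp, hq, Function.uncurry, mul_comm]
  have h2 : ‖ht.toLp _‖ = ‖f‖ * ‖g‖ := by
    rw [← sq_eq_sq₀ (norm_nonneg _) (by positivity), ← Lp.integral_sq, mul_pow,
      ← Lp.integral_sq f, ← Lp.integral_sq g, ← integral_prod_mul]
    refine integral_congr_ae ?_
    filter_upwards [ht.coeFn_toLp] with p hp
    rw [hp, mul_pow]
  rw [h1, ← h2, ← Lp.norm_toLp _ hk]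
  exact abs_real_inner_le_norm _ _

theorem norm_kernelOperator_le (hk : MemLp (Function.uncurry k) 2 (μ.prod μ)) (f : Lp ℝ 2 μ) :
    ‖kernelOperator μ k hk f‖ ≤ (eLpNorm (Function.uncurry k) 2 (μ.prod μ)).toReal * ‖f‖ := by
  have h := (le_abs_self _).trans
    (abs_inner_kernelOperator_le hk f (kernelOperator μ k hk f))
  rw [real_inner_self_eq_norm_sq] at h
  rcases eq_or_lt_of_le (norm_nonneg (kernelOperator μ k hk f)) with h0 | h0
  · rw [← h0]
    positivity
  · refine le_of_mul_le_mul_right ?_ h0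
    linarith

/-- The integral operator as a continuous linear map. -/
noncomputable def kernelCLM (hk : MemLp (Function.uncurry k) 2 (μ.prod μ)) :
    Lp ℝ 2 μ →L[ℝ] Lp ℝ 2 μ :=
  (kernelOperator μ k hk).mkContinuous _ (norm_kernelOperator_le hk)

theorem kernelOperator_sub {s : χ → χ → ℝ} (hk : MemLp (Function.uncurry k) 2 (μ.prod μ))
    (hs : MemLp (Function.uncurry s) 2 (μ.prod μ))
    (hr : MemLp (Function.uncurry fun x y => k x y - s x y) 2 (μ.prod μ)) (f : Lp ℝ 2 μ) :
    kernelOperator μ k hk f - kernelOperator μ s hs f = kernelOperator μ _ hr f := by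
  refine ext_inner_right ℝ fun g => ?_
  have ht := (Lp.memLp f).tensor (Lp.memLp g)
  rw [inner_sub_left, inner_kernelOperator, inner_kernelOperator, inner_kernelOperator]
  simp only [sub_mul]
  exact (integral_sub (hk.integrable_mul ht) (hs.integrable_mul ht)).symm

/-- The integral operator of a step kernel has finite rank. -/
theorem isCompactOperator_kernelCLM_of_step {s : χ → χ → ℝ}
    (hs : MemLp (Function.uncurry s) 2 (μ.prod μ)) (hstep : IsStepKernel (Function.uncurry s)) :
    IsCompactOperator (kernelCLM hs) := by
  obtain ⟨Φ, c, hc⟩ := hstep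
  set b : ℕ → Lp ℝ 2 μ := fun a =>
    indicatorConstLp 2 (Φ.measurableSet_fiber a) (measure_ne_top μ _) (1 : ℝ) with hb
  set W : Submodule ℝ (Lp ℝ 2 μ) := Submodule.span ℝ (b '' Φ.range) with hW
  have hfin : FiniteDimensional ℝ W :=
    FiniteDimensional.span_of_finite ℝ (Φ.range.finite_toSet.image b)
  have hmem : ∀ f, kernelCLM hs f ∈ W := fun f => by
    have : kernelCLM hs f = ∑ a ∈ Φ.range, (∫ x, c (Φ x) a * f x ∂μ) • b a := by
      refine Lp.ext ((kernelOperator_coeFn hs f).trans ?_)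
      have hall : ∀ᵐ y ∂μ, ∀ a : ℕ, b a y = (Φ ⁻¹' {a}).indicator (fun _ => (1 : ℝ)) y :=
        ae_all_iff.2 fun a => indicatorConstLp_coeFn
      have hsm : ∀ᵐ y ∂μ, ∀ a : ℕ, ((∫ x, c (Φ x) a * f x ∂μ) • b a : Lp ℝ 2 μ) y =
          (∫ x, c (Φ x) a * f x ∂μ) * b a y :=
        ae_all_iff.2 fun a => Lp.coeFn_smul _ _
      filter_upwards [hall, hsm, Lp.coeFn_finsetSum Φ.range
        fun a => (∫ x, c (Φ x) a * f x ∂μ) • b a] with y h1 h2 h3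
      rw [h3]
      simp only [Finset.sum_apply, h2, h1]
      rw [Finset.sum_eq_single (Φ y)]
      · have : ∀ x, s x y = c (Φ x) (Φ y) := fun x => congrFun hc (x, y)
        simp [this]
      · intro a _ ha
        simp [ha.symm]
      · intro h
        exact absurd (Φ.mem_range_self y) h
    rw [this]
    exact W.sum_mem fun a ha =>
      W.smul_mem _ (Submodule.subset_span (Set.mem_image_of_mem b ha))
  have hprop : ProperSpace W := FiniteDimensional.proper ℝ W
  have h : IsCompactOperator ((kernelCLM hs).codRestrict W hmem) :=
    isCompactOperator_of_locallyCompactSpace_dom _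
  exact h.clm_comp W.subtypeL

theorem isCompactOperator_kernelCLM (hk : MemLp (Function.uncurry k) 2 (μ.prod μ)) :
    IsCompactOperator (kernelCLM hk) := by
  choose s hle hstep using fun n : ℕ => exists_isStepKernel_eLpNorm_sub_le hk
    (ε := ENNReal.ofReal (1 / ((n : ℝ) + 1))) (by simp; positivity)
  have hs : ∀ n, MemLp (Function.uncurry (Function.curry (s n))) 2 (μ.prod μ) := fun n => by
    obtain ⟨D, hD⟩ := (hstep n).bounded
    exact MemLp.of_bound (hstep n).measurable.aestronglyMeasurable D (Eventually.of_forall hD)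
  refine isCompactOperator_of_tendsto (F := fun n => kernelCLM (hs n)) (l := atTop) ?_
    (Eventually.of_forall fun n =>
      isCompactOperator_kernelCLM_of_step (hs n) (by simpa using hstep n))
  rw [tendsto_iff_norm_sub_tendsto_zero]
  refine squeeze_zero (fun n => norm_nonneg _) (fun n => ?_)
    tendsto_one_div_add_atTop_nhds_zero_nat
  rw [norm_sub_rev]
  refine ContinuousLinearMap.opNorm_le_bound _ (by positivity) fun f => ?_
  have hr : MemLp (Function.uncurry fun x y => k x y - Function.curry (s n) x y) 2 (μ.prod μ) :=
    hk.sub (hs n)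
  have e : (kernelCLM hk - kernelCLM (hs n)) f = kernelOperator μ _ hr f :=
    kernelOperator_sub hk (hs n) hr f
  rw [e]
  refine (norm_kernelOperator_le hr f).trans ?_
  gcongr
  exact ENNReal.toReal_le_of_le_ofReal (by positivity) (hle n)

/-- As soon as it is known to have a positive eigenvalue, the integral operator of a symmetric
kernel has a largest one, which bounds its quadratic form. -/
theorem topEigenvalue_kernelOperator (hk : MemLp (Function.uncurry k) 2 (μ.prod μ))
    (hsymm : ∀ x y, k x y = k y x) {t : ℝ} (ht : 0 < t)
    (hev : Module.End.HasEigenvalue (kernelOperator μ k hk) t) :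
    0 < topEigenvalue (kernelOperator μ k hk) ∧
    Module.End.HasEigenvalue (kernelOperator μ k hk) (topEigenvalue (kernelOperator μ k hk)) ∧
    ∀ f, inner ℝ (kernelOperator μ k hk f) f ≤
      topEigenvalue (kernelOperator μ k hk) * ‖f‖ ^ 2 := by
  have hform : ∀ {r : ℝ} {f : Lp ℝ 2 μ}, kernelOperator μ k hk f = r • f →
      inner ℝ (kernelOperator μ k hk f) f = r * ‖f‖ ^ 2 := fun {r f} h => by
    rw [h, inner_smul_left, real_inner_self_eq_norm_sq]
    rfl
  obtain ⟨e, he⟩ := hev.exists_hasEigenvector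
  have hpos : 0 < inner ℝ (kernelOperator μ k hk e) e := by
    rw [hform he.apply_eq_smul]
    have := norm_pos_iff.2 he.2
    positivity
  obtain ⟨M, hM, hMe, hMf⟩ := exists_hasEigenvalue_of_compact (T := kernelCLM hk)
    (kernelOperator_isSymmetric hk hsymm) (isCompactOperator_kernelCLM hk) (x₀ := e) hpos
  have htop : topEigenvalue (kernelOperator μ k hk) = M := by
    refine IsGreatest.csSup_eq ⟨hMe, fun r hr => ?_⟩
    obtain ⟨f, hf⟩ := Module.End.HasEigenvalue.exists_hasEigenvector hr
    have h1 := hMf f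
    have h2 : inner ℝ (kernelCLM hk f) f = r * ‖f‖ ^ 2 := hform hf.apply_eq_smul
    rw [h2] at h1
    have := norm_pos_iff.2 hf.2
    exact le_of_mul_le_mul_right h1 (by positivity)
  rw [htop]
  exact ⟨hM, hMe, hMf⟩

end operator

/-! ### Lower bound for the largest eigenvalue of the Gram matrix -/

section lower
variable {χ Ω : Type*} [MeasurableSpace χ] [MeasurableSpace Ω] {μ : Measure χ}
  [IsProbabilityMeasure μ] {P : Measure Ω} [IsProbabilityMeasure P] {k : χ → χ → ℝ}
  {X : ℕ → Ω → χ}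

/-- An eigenfunction of a bounded kernel for a nonzero eigenvalue has a bounded measurable
representative, since `f = t⁻¹ T f`. -/
theorem exists_bounded_eigenfunction (hk : MemLp (Function.uncurry k) 2 (μ.prod μ)) {B : ℝ}
    (hB : ∀ x y, |k x y| ≤ B) {t : ℝ} (ht : t ≠ 0)
    (hev : Module.End.HasEigenvalue (kernelOperator μ k hk) t) :
    ∃ f : χ → ℝ, Measurable f ∧ (∃ D, ∀ x, |f x| ≤ D) ∧ 0 < ∫ x, f x ^ 2 ∂μ ∧
      ∫ p, k p.1 p.2 * (f p.1 * f p.2) ∂(μ.prod μ) = t * ∫ x, f x ^ 2 ∂μ := by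
  classical
  obtain ⟨e, he⟩ := hev.exists_hasEigenvector
  set D : ℝ := |t|⁻¹ * (B * ∫ x, |e x| ∂μ) with hD
  have hB0 : 0 ≤ B := by
    obtain ⟨x⟩ := nonempty_of_isProbabilityMeasure μ
    exact (abs_nonneg _).trans (hB x x)
  have hD0 : 0 ≤ D := by positivity
  have hei : Integrable e μ := (Lp.memLp e).integrable one_le_two
  have hbd : ∀ᵐ y ∂μ, |e y| ≤ D := by
    have h := kernelOperator_coeFn hk e
    rw [he.apply_eq_smul] at h
    filter_upwards [h, Lp.coeFn_smul t e] with y h1 h2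
    rw [h2, Pi.smul_apply, smul_eq_mul] at h1
    have h3 : |∫ x, k x y * e x ∂μ| ≤ B * ∫ x, |e x| ∂μ := by
      rw [← integral_const_mul, ← Real.norm_eq_abs]
      refine norm_integral_le_of_norm_le (hei.abs.const_mul B)
        (Eventually.of_forall fun x => ?_)
      rw [Real.norm_eq_abs, abs_mul]
      exact mul_le_mul_of_nonneg_right (hB x y) (abs_nonneg _)
    rw [← h1, abs_mul] at h3
    rw [hD, inv_mul_eq_div, le_div_iff₀ (abs_pos.2 ht), mul_comm]
    exact h3
  have hem : Measurable e := (Lp.stronglyMeasurable e).measurable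
  set f : χ → ℝ := fun x => if |e x| ≤ D then e x else 0 with hf
  have hfe : f =ᵐ[μ] e := by
    filter_upwards [hbd] with x hx
    simp [hf, hx]
  have hnorm : ∫ x, f x ^ 2 ∂μ = ‖e‖ ^ 2 := by
    rw [← Lp.integral_sq]
    refine integral_congr_ae ?_
    filter_upwards [hfe] with x hx
    rw [hx]
  refine ⟨f, Measurable.ite (measurableSet_le hem.abs measurable_const) hem measurable_const,
    ⟨D, fun x => ?_⟩, ?_, ?_⟩
  · by_cases h : |e x| ≤ D
    · simp [hf, h]
    · simp [hf, h, hD0]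
  · rw [hnorm]
    have := norm_pos_iff.2 he.2
    positivity
  · have h1 := inner_kernelOperator hk e e
    rw [he.apply_eq_smul, inner_smul_left, real_inner_self_eq_norm_sq] at h1
    rw [hnorm]
    refine Eq.trans ?_ h1.symm
    refine integral_congr_ae ?_
    filter_upwards [Measure.quasiMeasurePreserving_fst.ae hfe,
      Measure.quasiMeasurePreserving_snd.ae hfe] with p h2 h3
    rw [h2, h3]

/-- Strong law of large numbers for the quadratic form of the Gram matrix, evaluated at the sample
of a bounded function. -/
theorem ae_tendsto_gram_form (hmeas : Measurable (Function.uncurry k)) {B : ℝ}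
    (hB : ∀ x y, |k x y| ≤ B) (hX : ∀ i, Measurable (X i)) (hlaw : ∀ i, P.map (X i) = μ)
    (hindep : iIndepFun X P) {f : χ → ℝ} (hf : Measurable f) {D : ℝ} (hD : ∀ x, |f x| ≤ D) :
    ∀ᵐ ω ∂P, Tendsto (fun m : ℕ =>
      (∑ i : Fin m, ∑ j : Fin m, k (X i ω) (X j ω) * (f (X i ω) * f (X j ω))) / (m : ℝ) ^ 2)
      atTop (𝓝 (∫ p, k p.1 p.2 * (f p.1 * f p.2) ∂(μ.prod μ))) := by
  refine ae_tendsto_vStatistic hX hlaw hindep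
    (g := fun p => k p.1 p.2 * (f p.1 * f p.2)) (D := B * (D * D)) ?_ fun p => ?_
  · exact hmeas.mul ((hf.comp measurable_fst).mul (hf.comp measurable_snd))
  · have hD0 : 0 ≤ D := (abs_nonneg _).trans (hD p.1)
    rw [abs_mul, abs_mul]
    exact mul_le_mul (hB _ _) (mul_le_mul (hD _) (hD _) (abs_nonneg _) hD0) (by positivity)
      ((abs_nonneg _).trans (hB p.1 p.2))

/-- The integral operator of a positive semi-definite kernel has no negative eigenvalue: its form
at a bounded function is the limit of non-negative Gram forms. -/
theorem eigenvalue_kernelOperator_nonneg (hmeas : Measurable (Function.uncurry k)) {B : ℝ}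
    (hk : MemLp (Function.uncurry k) 2 (μ.prod μ)) (hB : ∀ x y, |k x y| ≤ B)
    (hpsd : (Matrix.of k : Matrix χ χ ℝ).PosSemidef)
    (hX : ∀ i, Measurable (X i)) (hlaw : ∀ i, P.map (X i) = μ) (hindep : iIndepFun X P) {t : ℝ}
    (hev : Module.End.HasEigenvalue (kernelOperator μ k hk) t) : 0 ≤ t := by
  rcases eq_or_ne t 0 with rfl | ht
  · exact le_rfl
  obtain ⟨f, hf, ⟨D, hD⟩, hpos, hform⟩ := exists_bounded_eigenfunction hk hB ht hev
  obtain ⟨ω, hω⟩ := (ae_tendsto_gram_form hmeas hB hX hlaw hindep hf hD).exists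
  have h : 0 ≤ t * ∫ x, f x ^ 2 ∂μ := by
    rw [← hform]
    refine ge_of_tendsto' hω fun m => div_nonneg ?_ (sq_nonneg _)
    exact gramMatrix_sum_nonneg hpsd (fun i => X i ω) m fun i => f (X i ω)
  exact nonneg_of_mul_nonneg_left h hpos

/-- Lower bound for the largest eigenvalue of the Gram matrix, by testing its form at the sampled
eigenfunction. -/
theorem ae_eventually_lt_topEigenvalue_gramMatrix (hmeas : Measurable (Function.uncurry k))
    {B : ℝ} (hk : MemLp (Function.uncurry k) 2 (μ.prod μ)) (hB : ∀ x y, |k x y| ≤ B)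
    (hsymm : ∀ x y, k x y = k y x)
    (hX : ∀ i, Measurable (X i)) (hlaw : ∀ i, P.map (X i) = μ) (hindep : iIndepFun X P) {t : ℝ}
    (ht : t ≠ 0) (hev : Module.End.HasEigenvalue (kernelOperator μ k hk) t) :
    ∀ᵐ ω ∂P, ∀ c < t, ∀ᶠ m : ℕ in atTop,
      c < topEigenvalue (Matrix.toLin' (gramMatrix k (fun i => X i ω) m)) / m := by
  obtain ⟨f, hf, ⟨D, hD⟩, hpos, hform⟩ := exists_bounded_eigenfunction hk hB ht hev
  have hD2 : ∀ x, |f x ^ 2| ≤ D ^ 2 := fun x => by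
    rw [abs_pow]
    exact pow_le_pow_left₀ (abs_nonneg _) (hD x) 2
  filter_upwards [ae_tendsto_gram_form hmeas hB hX hlaw hindep hf hD,
    ae_tendsto_average hX hlaw hindep (hf.pow_const 2) hD2] with ω h1 h2 c hc
  have h3 := h1.div h2 hpos.ne'
  rw [hform, mul_div_cancel_right₀ _ hpos.ne'] at h3
  filter_upwards [h3.eventually_const_lt hc, h2.eventually_const_lt hpos, eventually_ge_atTop 1]
    with m h4 h5 hm
  have : NeZero m := ⟨by omega⟩
  have hm' : (0 : ℝ) < m := by exact_mod_cast hm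
  refine h4.trans_le ?_
  have h6 := ((gramMatrix_isHermitian hsymm (fun i => X i ω) m).topEigenvalue_le_iff_sum).1
    le_rfl (fun i => f (X i ω))
  simp only [gramMatrix, Matrix.of_apply] at h6 ⊢
  have h7 : 0 < ∑ i : Fin m, f (X i ω) ^ 2 := by
    have := mul_pos h5 hm'
    rwa [div_mul_cancel₀ _ hm'.ne'] at this
  simp only [Pi.div_apply]
  rw [div_le_iff₀ h5, div_le_iff₀ (by positivity)]
  refine h6.trans (le_of_eq ?_)
  field_simp

end lower

/-! ### Upper bound for the largest eigenvalue of the Gram matrix -/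

section upper
variable {χ Ω : Type*} [MeasurableSpace χ] [MeasurableSpace Ω] {μ : Measure χ}
  [IsProbabilityMeasure μ] {P : Measure Ω} [IsProbabilityMeasure P] {k : χ → χ → ℝ}
  {X : ℕ → Ω → χ}

theorem integral_comp_simpleFunc (Φ : SimpleFunc χ ℕ) (w : ℕ → ℝ) :
    ∫ x, w (Φ x) ∂μ = ∑ a ∈ Φ.range, w a * μ.real (Φ ⁻¹' {a}) := by
  have h : ∀ x, w (Φ x) = ∑ a ∈ Φ.range, (Φ ⁻¹' {a}).indicator (fun _ => w a) x := fun x => by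
    rw [Finset.sum_eq_single (Φ x)]
    · simp
    · intro a _ ha
      simp [ha.symm]
    · intro h
      exact absurd (Φ.mem_range_self x) h
  simp only [h]
  rw [integral_finsetSum _ fun a _ =>
    (integrable_const (w a)).indicator (Φ.measurableSet_fiber a)]
  refine Finset.sum_congr rfl fun a _ => ?_
  rw [integral_indicator_const _ (Φ.measurableSet_fiber a), smul_eq_mul, mul_comm]

theorem integral_prod_comp_simpleFunc (Φ : SimpleFunc χ ℕ) (w : ℕ → ℕ → ℝ) :
    ∫ p, w (Φ p.1) (Φ p.2) ∂(μ.prod μ) =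
      ∑ a ∈ Φ.range, ∑ b ∈ Φ.range, w a b * μ.real (Φ ⁻¹' {b}) * μ.real (Φ ⁻¹' {a}) := by
  have hs : IsStepKernel fun p : χ × χ => w (Φ p.1) (Φ p.2) := ⟨Φ, w, rfl⟩
  obtain ⟨D, hD⟩ := hs.bounded
  rw [integral_prod _ (Integrable.of_bound hs.measurable.aestronglyMeasurable D
    (Eventually.of_forall hD))]
  simp only [integral_comp_simpleFunc Φ (w _)]
  rw [integral_comp_simpleFunc Φ fun a => ∑ b ∈ Φ.range, w a b * μ.real (Φ ⁻¹' {b})]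
  simp only [Finset.sum_mul]

/-- Replacing a kernel by an approximation in `L²(μ ⊗ μ)` raises its quadratic form, relative to
`‖f‖ ^ 2`, by at most the distance. -/
theorem integral_form_le_of_eLpNorm_sub_le
    (hk : MemLp (Function.uncurry k) 2 (μ.prod μ)) {M : ℝ}
    (hM : ∀ f, inner ℝ (kernelOperator μ k hk f) f ≤ M * ‖f‖ ^ 2)
    {s : χ → χ → ℝ} (hs : MemLp (Function.uncurry s) 2 (μ.prod μ)) {ε : ℝ} (hε : 0 ≤ ε)
    (hks : eLpNorm (Function.uncurry k - Function.uncurry s) 2 (μ.prod μ) ≤ ENNReal.ofReal ε)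
    {f : χ → ℝ} (hf : MemLp f 2 μ) :
    ∫ p, s p.1 p.2 * (f p.1 * f p.2) ∂(μ.prod μ) ≤ (M + ε) * ∫ x, f x ^ 2 ∂μ := by
  have hr : MemLp (Function.uncurry fun x y => k x y - s x y) 2 (μ.prod μ) := hk.sub hs
  have hfe := hf.coeFn_toLp
  have h1 : ∫ p, s p.1 p.2 * (f p.1 * f p.2) ∂(μ.prod μ) =
      inner ℝ (kernelOperator μ s hs (hf.toLp f)) (hf.toLp f) := by
    rw [inner_kernelOperator]
    refine integral_congr_ae ?_
    filter_upwards [Measure.quasiMeasurePreserving_fst.ae hfe,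
      Measure.quasiMeasurePreserving_snd.ae hfe] with p h2 h3
    rw [h2, h3]
  have h2 : ∫ x, f x ^ 2 ∂μ = ‖hf.toLp f‖ ^ 2 := by
    rw [← Lp.integral_sq]
    refine integral_congr_ae ?_
    filter_upwards [hfe] with x hx
    rw [hx]
  have h3 : kernelOperator μ s hs (hf.toLp f) =
      kernelOperator μ k hk (hf.toLp f) - kernelOperator μ _ hr (hf.toLp f) := by
    rw [← kernelOperator_sub hk hs hr, sub_sub_cancel]
  have h4 := abs_inner_kernelOperator_le hr (hf.toLp f) (hf.toLp f)
  have h5 : (eLpNorm (Function.uncurry fun x y => k x y - s x y) 2 (μ.prod μ)).toReal ≤ ε :=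
    ENNReal.toReal_le_of_le_ofReal hε hks
  have h6 := h4.trans (mul_le_mul_of_nonneg_right h5 (by positivity))
  rw [h1, h2, h3, inner_sub_left]
  have := (abs_le.1 h6).1
  have := hM (hf.toLp f)
  nlinarith

/-- Comparison of an empirical step-kernel form with the population form: if each cell `a` of weight
`p a` receives at most `L * p a` sample points, then a bound `Λ` for the population form yields the
bound `Λ * L` for the empirical one. -/
theorem step_form_le {m : ℕ} (R : Finset ℕ) (z : Fin m → ℕ) (hz : ∀ i, z i ∈ R)
    (c : ℕ → ℕ → ℝ) (p : ℕ → ℝ) {Λ L : ℝ} (hΛ : 0 ≤ Λ)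
    (hform : ∀ v : ℕ → ℝ, ∑ a ∈ R, ∑ b ∈ R, c a b * (v a * v b) * p b * p a ≤
      Λ * ∑ a ∈ R, v a ^ 2 * p a) (hp : ∀ a, 0 ≤ p a)
    (hcount : ∀ a ∈ R, ((Finset.univ.filter fun i => z i = a).card : ℝ) ≤ L * p a)
    (u : Fin m → ℝ) :
    ∑ i, ∑ j, c (z i) (z j) * (u i * u j) ≤ Λ * L * ∑ i, u i ^ 2 := by
  -- The empirical form at `u` is the population form at `v a = U a / p a`, where `U a` is the sum
  -- of `u` over cell `a`; on a cell with `p a = 0` the quotient is `0`, and so is `U a`.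
  set U : ℕ → ℝ := fun a => ∑ i with z i = a, u i with hU
  have hgroup : ∀ w : ℕ → ℝ, ∑ i, w (z i) * u i = ∑ a ∈ R, w a * U a := fun w => by
    rw [← Finset.sum_fiberwise_of_maps_to (g := z) (t := R) fun i _ => hz i]
    refine Finset.sum_congr rfl fun a _ => ?_
    rw [hU, Finset.mul_sum]
    refine Finset.sum_congr rfl fun i hi => ?_
    rw [(Finset.mem_filter.1 hi).2]
  have hsq : ∀ a ∈ R, U a ^ 2 ≤ L * p a * ∑ i with z i = a, u i ^ 2 := fun a ha =>
    sq_sum_le_card_mul_sum_sq.trans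
      (mul_le_mul_of_nonneg_right (hcount a ha) (Finset.sum_nonneg fun i _ => sq_nonneg _))
  have hzero : ∀ a ∈ R, p a = 0 → U a = 0 := fun a ha h => by
    have := hsq a ha
    rw [h, mul_zero, zero_mul] at this
    exact pow_eq_zero_iff two_ne_zero |>.1 (le_antisymm this (sq_nonneg _))
  have hdiv : ∀ a ∈ R, U a / p a * p a = U a := fun a ha => by
    by_cases h : p a = 0
    · simp [h, hzero a ha h]
    · exact div_mul_cancel₀ _ h
  have h1 : ∑ i, ∑ j, c (z i) (z j) * (u i * u j) =
      ∑ a ∈ R, ∑ b ∈ R, c a b * (U a / p a * (U b / p b)) * p b * p a := by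
    calc ∑ i, ∑ j, c (z i) (z j) * (u i * u j)
        = ∑ i, (∑ j, c (z i) (z j) * u j) * u i := by
          refine Finset.sum_congr rfl fun i _ => ?_
          rw [Finset.sum_mul]
          exact Finset.sum_congr rfl fun j _ => by ring
      _ = ∑ i, (∑ b ∈ R, c (z i) b * U b) * u i := by
          refine Finset.sum_congr rfl fun i _ => ?_
          rw [hgroup (c (z i))]
      _ = ∑ a ∈ R, (∑ b ∈ R, c a b * U b) * U a := hgroup fun a => ∑ b ∈ R, c a b * U b
      _ = _ := by
          refine Finset.sum_congr rfl fun a ha => ?_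
          rw [Finset.sum_mul]
          refine Finset.sum_congr rfl fun b hb => ?_
          conv_lhs => rw [← hdiv a ha, ← hdiv b hb]
          ring
  rw [h1, mul_assoc]
  refine (hform fun a => U a / p a).trans (mul_le_mul_of_nonneg_left ?_ hΛ)
  calc ∑ a ∈ R, (U a / p a) ^ 2 * p a
      ≤ ∑ a ∈ R, L * ∑ i with z i = a, u i ^ 2 := by
        refine Finset.sum_le_sum fun a ha => ?_
        rcases eq_or_lt_of_le (hp a) with h0 | h0
        · rw [← h0, mul_zero]
          by_cases hemp : (Finset.univ.filter fun i => z i = a) = ∅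
          · simp [hemp]
          · have := hcount a ha
            rw [← h0, mul_zero] at this
            have h' : (Finset.univ.filter fun i => z i = a).card = 0 := by
              exact_mod_cast le_antisymm this (Nat.cast_nonneg _)
            exact absurd (Finset.card_eq_zero.1 h') hemp
        · have h2 := hsq a ha
          have e : (U a / p a) ^ 2 * p a = U a ^ 2 / p a := by field_simp
          rw [e, div_le_iff₀ h0]
          linarith
    _ = L * ∑ i, u i ^ 2 := by
        rw [← Finset.mul_sum, Finset.sum_fiberwise_of_maps_to (g := z) (t := R) fun i _ => hz i]

/-- Almost surely, eventually every cell of a finite measurable partition receives at most `1 + ε`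
times its expected number of sample points; null cells receive none. -/
theorem ae_eventually_card_fiber_le (hX : ∀ i, Measurable (X i))
    (hlaw : ∀ i, P.map (X i) = μ) (hindep : iIndepFun X P) (Φ : SimpleFunc χ ℕ) {ε : ℝ}
    (hε : 0 < ε) :
    ∀ᵐ ω ∂P, ∀ᶠ m : ℕ in atTop, ∀ a ∈ Φ.range,
      ((Finset.univ.filter fun i : Fin m => Φ (X i ω) = a).card : ℝ) ≤
        m * (1 + ε) * μ.real (Φ ⁻¹' {a}) := by
  suffices h : ∀ a : ℕ, ∀ᵐ ω ∂P, ∀ᶠ m : ℕ in atTop,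
      ((Finset.univ.filter fun i : Fin m => Φ (X i ω) = a).card : ℝ) ≤
        m * (1 + ε) * μ.real (Φ ⁻¹' {a}) by
    filter_upwards [ae_all_iff.2 h] with ω hω
    exact (Finset.eventually_all _).2 fun a _ => hω a
  intro a
  have hA := Φ.measurableSet_fiber a
  rcases eq_or_lt_of_le (measureReal_nonneg (μ := μ) (s := Φ ⁻¹' {a})) with h0 | h0
  · have hnull : μ (Φ ⁻¹' {a}) = 0 := (measureReal_eq_zero_iff).1 h0.symm
    have hne : ∀ᵐ ω ∂P, ∀ i, Φ (X i ω) ≠ a := ae_all_iff.2 fun i => by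
      rw [← hlaw i, Measure.map_apply (hX i) hA] at hnull
      exact measure_eq_zero_iff_ae_notMem.1 hnull
    filter_upwards [hne] with ω hω
    refine Eventually.of_forall fun m => ?_
    rw [← h0]
    simp [hω]
  · have hav := ae_tendsto_average hX hlaw hindep
      (f := (Φ ⁻¹' {a}).indicator fun _ => (1 : ℝ)) (measurable_const.indicator hA) (D := 1)
      fun x => by by_cases h : x ∈ Φ ⁻¹' {a} <;> simp [h]
    rw [integral_indicator_const _ hA, smul_eq_mul, mul_one] at hav
    filter_upwards [hav] with ω hω
    filter_upwards [hω.eventually_lt_const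
      (show μ.real (Φ ⁻¹' {a}) < (1 + ε) * μ.real (Φ ⁻¹' {a}) by nlinarith),
      eventually_ge_atTop 1] with m hm hm1
    have hm' : (0 : ℝ) < m := by exact_mod_cast hm1
    rw [div_lt_iff₀ hm'] at hm
    have e : ((Finset.univ.filter fun i : Fin m => Φ (X i ω) = a).card : ℝ) =
        ∑ i : Fin m, (Φ ⁻¹' {a}).indicator (fun _ => (1 : ℝ)) (X i ω) := by
      rw [Finset.card_filter]
      push_cast
      refine Finset.sum_congr rfl fun i _ => ?_
      by_cases h : Φ (X i ω) = a <;> simp [h]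
    rw [e]
    linarith

/-- A quadratic form is bounded by the Frobenius norm of its matrix. -/
theorem sum_form_le_sqrt {m : ℕ} (r : Fin m → Fin m → ℝ) (u : Fin m → ℝ) :
    ∑ i, ∑ j, r i j * (u i * u j) ≤ √(∑ i, ∑ j, r i j ^ 2) * ∑ i, u i ^ 2 := by
  have h := Real.sum_mul_le_sqrt_mul_sqrt (Finset.univ : Finset (Fin m × Fin m))
    (fun p => r p.1 p.2) (fun p => u p.1 * u p.2)
  have e : ∑ p : Fin m × Fin m, (u p.1 * u p.2) ^ 2 = (∑ i, u i ^ 2) ^ 2 := by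
    rw [sq (∑ i, u i ^ 2), Finset.sum_mul_sum, ← Finset.sum_product', Finset.univ_product_univ]
    exact Finset.sum_congr rfl fun p _ => by ring
  rw [e, Real.sqrt_sq (Finset.sum_nonneg fun i _ => sq_nonneg _)] at h
  simpa only [Fintype.sum_prod_type] using h

/-- Upper bound for the largest eigenvalue of the Gram matrix. A step kernel close to `k` obeys the
bound by comparison of cell counts with cell weights, and the remainder is small in Frobenius norm
by the law of large numbers for its square. -/
theorem ae_eventually_topEigenvalue_gramMatrix_le (hmeas : Measurable (Function.uncurry k))
    {B : ℝ} (hk : MemLp (Function.uncurry k) 2 (μ.prod μ)) (hB : ∀ x y, |k x y| ≤ B)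
    (hsymm : ∀ x y, k x y = k y x)
    (hX : ∀ i, Measurable (X i)) (hlaw : ∀ i, P.map (X i) = μ) (hindep : iIndepFun X P) {M : ℝ}
    (hM0 : 0 ≤ M) (hM : ∀ f, inner ℝ (kernelOperator μ k hk f) f ≤ M * ‖f‖ ^ 2) {ε : ℝ}
    (hε : 0 < ε) :
    ∀ᵐ ω ∂P, ∀ᶠ m : ℕ in atTop,
      topEigenvalue (Matrix.toLin' (gramMatrix k (fun i => X i ω) m)) / m ≤
        (M + ε) * (1 + ε) + 2 * ε := by
  obtain ⟨s', hks, hstep⟩ := exists_isStepKernel_eLpNorm_sub_le hk (ε := ENNReal.ofReal ε)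
    (by simpa using hε)
  obtain ⟨D, hD⟩ := hstep.bounded
  have hsm := hstep.measurable
  obtain ⟨Φ, c, hc⟩ := hstep
  have hs : MemLp (Function.uncurry (Function.curry s')) 2 (μ.prod μ) :=
    MemLp.of_bound hsm.aestronglyMeasurable D (Eventually.of_forall hD)
  have hform : ∀ v : ℕ → ℝ, ∑ a ∈ Φ.range, ∑ b ∈ Φ.range,
      c a b * (v a * v b) * μ.real (Φ ⁻¹' {b}) * μ.real (Φ ⁻¹' {a}) ≤
      (M + ε) * ∑ a ∈ Φ.range, v a ^ 2 * μ.real (Φ ⁻¹' {a}) := fun v => by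
    have hv : MemLp (fun x => v (Φ x)) 2 μ := (Φ.map v).memLp_of_isFiniteMeasure 2 μ
    have h := integral_form_le_of_eLpNorm_sub_le hk hM hs hε.le (by simpa using hks) hv
    rw [integral_comp_simpleFunc Φ fun a => v a ^ 2] at h
    rw [← integral_prod_comp_simpleFunc Φ fun a b => c a b * (v a * v b)]
    simpa [hc] using h
  set r : χ × χ → ℝ := fun p => k p.1 p.2 - c (Φ p.1) (Φ p.2) with hr
  have hrm : Measurable r := by
    rw [hc] at hsm
    exact hmeas.sub hsm
  have hrb : ∀ p, |r p ^ 2| ≤ (B + D) ^ 2 := fun p => by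
    rw [abs_pow]
    refine pow_le_pow_left₀ (abs_nonneg _) ((abs_sub _ _).trans (add_le_add (hB _ _) ?_)) 2
    have := hD p
    rwa [hc] at this
  have hrint : ∫ p, r p ^ 2 ∂(μ.prod μ) < (2 * ε) ^ 2 := by
    have hrL : MemLp r 2 (μ.prod μ) := by
      have := hk.sub hs
      simpa [hc] using! this
    have h1 : ∫ p, r p ^ 2 ∂(μ.prod μ) = ‖hrL.toLp r‖ ^ 2 := by
      rw [← Lp.integral_sq]
      refine integral_congr_ae ?_
      filter_upwards [hrL.coeFn_toLp] with p hp
      rw [hp]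
    have h2 : ‖hrL.toLp r‖ ≤ ε := by
      rw [Lp.norm_toLp]
      refine ENNReal.toReal_le_of_le_ofReal hε.le (le_trans (le_of_eq ?_) hks)
      rw [hc]
      rfl
    rw [h1]
    have := norm_nonneg (hrL.toLp r)
    nlinarith
  filter_upwards [ae_tendsto_vStatistic hX hlaw hindep (hrm.pow_const 2) hrb,
    ae_eventually_card_fiber_le hX hlaw hindep Φ hε] with ω h1 h2
  filter_upwards [h1.eventually_lt_const hrint, h2, eventually_ge_atTop 1] with m h3 h4 hm
  have : NeZero m := ⟨by omega⟩
  have hm' : (0 : ℝ) < m := by exact_mod_cast hm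
  rw [div_le_iff₀ hm', (gramMatrix_isHermitian hsymm _ m).topEigenvalue_le_iff_sum]
  intro u
  have hu : 0 ≤ ∑ i, u i ^ 2 := Finset.sum_nonneg fun i _ => sq_nonneg _
  have h5 := step_form_le Φ.range (fun i : Fin m => Φ (X i ω)) (fun i => Φ.mem_range_self _) c
    (fun a => μ.real (Φ ⁻¹' {a})) (by positivity) hform (fun a => measureReal_nonneg) h4 u
  have h6 := sum_form_le_sqrt (fun i j : Fin m => r (X i ω, X j ω)) u
  have h7 : √(∑ i : Fin m, ∑ j : Fin m, r (X i ω, X j ω) ^ 2) ≤ 2 * ε * m := by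
    refine Real.sqrt_le_iff.2 ⟨by positivity, ?_⟩
    rw [div_lt_iff₀ (by positivity)] at h3
    rw [mul_pow]
    exact h3.le
  have h8 := h6.trans (mul_le_mul_of_nonneg_right h7 hu)
  have e : ∑ i : Fin m, ∑ j : Fin m, gramMatrix k (fun i => X i ω) m i j * (u i * u j) =
      (∑ i : Fin m, ∑ j : Fin m, c (Φ (X i ω)) (Φ (X j ω)) * (u i * u j)) +
      ∑ i : Fin m, ∑ j : Fin m, r (X i ω, X j ω) * (u i * u j) := by
    rw [← Finset.sum_add_distrib]
    refine Finset.sum_congr rfl fun i _ => ?_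
    rw [← Finset.sum_add_distrib]
    refine Finset.sum_congr rfl fun j _ => ?_
    simp only [gramMatrix, Matrix.of_apply, hr]
    ring
  rw [e]
  linarith

end upper

/-! ### Almost sure limits -/

/-- The largest eigenvalue of the Gram matrix, divided by the sample size, converges almost surely
to the largest eigenvalue of the integral operator. -/
theorem ae_tendsto_topEigenvalue_gramMatrix {χ Ω : Type*} [MeasurableSpace χ]
    [MeasurableSpace Ω] {μ : Measure χ} [IsProbabilityMeasure μ] {P : Measure Ω}
    [IsProbabilityMeasure P] {k : χ → χ → ℝ} {X : ℕ → Ω → χ}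
    (hmeas : Measurable (Function.uncurry k)) {B : ℝ}
    (hk : MemLp (Function.uncurry k) 2 (μ.prod μ)) (hB : ∀ x y, |k x y| ≤ B)
    (hsymm : ∀ x y, k x y = k y x) (hX : ∀ i, Measurable (X i)) (hlaw : ∀ i, P.map (X i) = μ)
    (hindep : iIndepFun X P) (hpos : 0 < topEigenvalue (kernelOperator μ k hk))
    (hev : Module.End.HasEigenvalue (kernelOperator μ k hk)
      (topEigenvalue (kernelOperator μ k hk)))
    (hform : ∀ f, inner ℝ (kernelOperator μ k hk f) f ≤
      topEigenvalue (kernelOperator μ k hk) * ‖f‖ ^ 2) :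
    ∀ᵐ ω ∂P, Tendsto (fun m : ℕ =>
        topEigenvalue (Matrix.toLin' (gramMatrix k (fun i => X i ω) m)) / m) atTop
      (𝓝 (topEigenvalue (kernelOperator μ k hk))) := by
  set M := topEigenvalue (kernelOperator μ k hk)
  have hup : ∀ᵐ ω ∂P, ∀ n : ℕ, ∀ᶠ m : ℕ in atTop,
      topEigenvalue (Matrix.toLin' (gramMatrix k (fun i => X i ω) m)) / m ≤
        (M + 1 / ((n : ℝ) + 1)) * (1 + 1 / ((n : ℝ) + 1)) + 2 * (1 / ((n : ℝ) + 1)) :=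
    ae_all_iff.2 fun n => ae_eventually_topEigenvalue_gramMatrix_le hmeas hk hB hsymm hX hlaw
      hindep hpos.le hform (by positivity)
  have hlim : Tendsto (fun n : ℕ =>
      (M + 1 / ((n : ℝ) + 1)) * (1 + 1 / ((n : ℝ) + 1)) + 2 * (1 / ((n : ℝ) + 1))) atTop
      (𝓝 M) := by
    have h := tendsto_one_div_add_atTop_nhds_zero_nat (𝕜 := ℝ)
    simpa using ((h.const_add M).mul (h.const_add 1)).add (h.const_mul 2)
  filter_upwards [hup, ae_eventually_lt_topEigenvalue_gramMatrix hmeas hk hB hsymm hX hlaw hindep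
    hpos.ne' hev] with ω h1 h2
  refine tendsto_order.2 ⟨h2, fun c hc => ?_⟩
  obtain ⟨n, hn⟩ := (hlim.eventually_lt_const hc).exists
  filter_upwards [h1 n] with m hm
  exact hm.trans_lt hn

theorem theorem1 {χ Ω : Type*} [MeasurableSpace χ] [MeasurableSpace Ω]
    (μ : Measure χ) [IsProbabilityMeasure μ] (P : Measure Ω) [IsProbabilityMeasure P]
    (k : χ → χ → ℝ)
    (hmeas : Measurable (Function.uncurry k))
    (hL2 : MemLp (Function.uncurry k) 2 (μ.prod μ))
    (hsymm : ∀ x y, k x y = k y x)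
    (hpsd : (Matrix.of k : Matrix χ χ ℝ).PosSemidef)
    (hdiag : ∃ B : ℝ, ∀ x, |k x x| ≤ B)
    (hlam : topEigenvalue (kernelOperator μ k hL2) ≠ 0)
    (X : ℕ → Ω → χ)
    (hX : ∀ i, Measurable (X i))
    (hlaw : ∀ i, P.map (X i) = μ)
    (hindep : iIndepFun X P) :
    ∃ C : Ω → ℝ, Measurable C ∧ (∀ ω, 0 ≤ C ω) ∧
      (∀ ω, Tendsto (fun m : ℕ =>
          bottomEigenvalue (Matrix.toLin' (gramMatrix k (fun i => X i ω) m)))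
        atTop (𝓝 (C ω))) ∧
      ∀ σ : ℝ, 0 < σ → ∀ᵐ ω ∂P,
        Tendsto (fun m : ℕ =>
            (C ω + σ ^ 2) / (topEigenvalue (kernelOperator μ k hL2) * (m : ℝ)) *
              conditionNumber (gramMatrix k (fun i => X i ω) m +
                σ ^ 2 • (1 : Matrix (Fin m) (Fin m) ℝ)))
          atTop (𝓝 1) := by
  obtain ⟨B, hBd⟩ := hdiag
  have hB := abs_le_of_posSemidef hpsd hsymm hBd
  obtain ⟨C, hCm, hC0, hC⟩ := exists_tendsto_bottomEigenvalue_gramMatrix hmeas hsymm hpsd hX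
  refine ⟨C, hCm, hC0, hC, fun σ hσ => ?_⟩
  -- The supremum of the empty set is `0`, so a nonzero `topEigenvalue` forces an eigenvalue, and
  -- as no eigenvalue is negative one of them is positive.
  obtain ⟨t, ht, hev⟩ : ∃ t, 0 < t ∧ Module.End.HasEigenvalue (kernelOperator μ k hL2) t := by
    by_contra! hne
    have hz : ∀ t, Module.End.HasEigenvalue (kernelOperator μ k hL2) t → t = 0 := fun t h =>
      le_antisymm (not_lt.1 fun h0 => hne t h0 h)
        (eigenvalue_kernelOperator_nonneg hmeas hL2 hB hpsd hX hlaw hindep h)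
    exact hlam (le_antisymm (Real.sSup_le (fun t h => (hz t h).le) le_rfl)
      (Real.sSup_nonneg fun t h => (hz t h).ge))
  obtain ⟨hpos, htop, hform⟩ := topEigenvalue_kernelOperator hL2 hsymm ht hev
  filter_upwards [ae_tendsto_topEigenvalue_gramMatrix hmeas hL2 hB hsymm hX hlaw hindep hpos htop
    hform] with ω hω
  have hσ2 : 0 < σ ^ 2 := by positivity
  have hCσ : C ω + σ ^ 2 ≠ 0 := (add_pos_of_nonneg_of_pos (hC0 ω) hσ2).ne'
  have h1 := (tendsto_const_nhds (x := C ω + σ ^ 2)).div ((hC ω).add_const (σ ^ 2)) hCσ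
  have h2 := (hω.add (tendsto_const_div_atTop_nhds_zero_nat (σ ^ 2))).div_const
    (topEigenvalue (kernelOperator μ k hL2))
  rw [add_zero, div_self hpos.ne'] at h2
  rw [div_self hCσ] at h1
  have h3 := h1.mul h2
  rw [one_mul] at h3
  refine h3.congr' ?_
  filter_upwards [eventually_ge_atTop 1] with m hm
  have : NeZero m := ⟨by omega⟩
  have hA := gramMatrix_isHermitian hsymm (fun i => X i ω) m
  rw [conditionNumber, hA.topEigenvalue_add_smul_one, hA.bottomEigenvalue_add_smul_one,
    Pi.div_apply, ← add_div, div_div, div_mul_div_comm, div_mul_div_comm]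
  congr 1
  ring
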